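/- Let $p>0$ be real and let $E=E(1,1,p)=\{(z,w)\in\mathbb{C}^2 : |z|^2+|w|^{2p}<1\}$. Let $K_E(\zeta,\bar\zeta)=\sum_{j}|\varphi_j(\zeta)|^2$ be the Bergman kernel of $E$ on the diagonal, where $(\varphi_j)$ is an orthonormal basis of the space of holomorphic functions in $L^2(E)$, and let $g$ be the Bergman metric of $E$, with components $g_{a\bar b}=\partial^2\log K_E/\partial z_a\partial\bar z_b$ in the coordinates $(z_1,z_2)=(z,w)$. Its curvature components are $$R_{a\bar b c\bar d}=-\frac{\partial^2 g_{a\bar b}}{\partial z_c\partial\bar z_d}+\sum_{r,s=1}^{2}g^{s\bar r}\frac{\partial g_{a\bar r}}{\partial z_c}\frac{\partial g_{s\bar b}}{\partial\bar z_d},$$ where $\sum_r g_{a\bar r}g^{s\bar r}=\delta_{as}$, and its holomorphic sectional curvature in the direction $\xi=\sum_a\xi_a\,\partial/\partial z_a\neq 0$ is $$h(\xi)=\frac{\sum_{a,b,c,d}R_{a\bar b c\bar d}\,\xi_a\bar\xi_b\xi_c\bar\xi_d}{\bigl(\sum_{a,b}g_{a\bar b}\,\xi_a\bar\xi_b\bigr)^2}.$$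 Then at every point $(z,w)\in E$ with $z=\bar z$ and $w=0$, $$h\Bigl(\frac{\partial}{\partial z}\Bigr)=-\frac{2p}{1+2p},\qquad h\Bigl(\frac{\partial}{\partial w}\Bigr)=-\frac{1+4p+p^2}{(2+p)^2}.$$ In particular, at every such point, $h(\partial/\partial z)=h(\partial/\partial w)$ if and only if $p=1$. -/

import Mathlib

open MeasureTheory

/-- The ellipsoid `E(1,1,p) = {(z,w) : |z|^2 + |w|^(2p) < 1}` in `ℂ²`, with `z = q 0` and `w = q 1`. -/
def ellipsoid (p : ℝ) : Set (Fin 2 → ℂ) :=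
  {q | ‖q 0‖ ^ 2 + ‖q 1‖ ^ (2 * p) < 1}

/-- `f` belongs to `A²(G)`: it is holomorphic on `G` and square integrable on `G`
with respect to Lebesgue measure. -/
def InBergmanSpace {n : ℕ} (G : Set (Fin n → ℂ)) (f : (Fin n → ℂ) → ℂ) : Prop :=
  DifferentiableOn ℂ f G ∧ MemLp f 2 (volume.restrict G)

/-- `φ 0, φ 1, …` is an orthonormal basis of `A²(G)` for the `L²` inner product: an orthonormal
sequence in `A²(G)` whose finite linear combinations are `L²`-dense in `A²(G)`. -/
structure IsBergmanBasis {n : ℕ} (G : Set (Fin n → ℂ)) (φ : ℕ → (Fin n → ℂ) → ℂ) : Prop where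
  mem : ∀ j, InBergmanSpace G (φ j)
  orthonormal : ∀ i j, ∫ z in G, φ i z * starRingEnd ℂ (φ j z) = if i = j then 1 else 0
  dense : ∀ f, InBergmanSpace G f → ∀ ε : ENNReal, 0 < ε →
    ∃ (N : ℕ) (c : ℕ → ℂ),
      eLpNorm (fun z => f z - ∑ j ∈ Finset.range N, c j * φ j z) 2 (volume.restrict G) < ε

open Classical in
/-- The Bergman kernel on the diagonal, `K_G(z, z̄) = ∑ⱼ φⱼ(z) conj(φⱼ(z)) = ∑ⱼ |φⱼ(z)|²`, for an
orthonormal basis `φ` of `A²(G)`. For `z` in a bounded domain `G` the value does not depend on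
the basis. The value `0` in the absence of such a basis is a convention. -/
noncomputable def bergmanKernel {n : ℕ} (G : Set (Fin n → ℂ)) (z : Fin n → ℂ) : ℝ :=
  if h : ∃ φ, IsBergmanBasis G φ then ∑' j, ‖h.choose j z‖ ^ 2 else 0

/-- The Wirtinger derivative `∂f/∂z_i = (∂f/∂x_i - √-1 ∂f/∂y_i) / 2`. -/
noncomputable def dz {n : ℕ} (i : Fin n) (f : (Fin n → ℂ) → ℂ) (z : Fin n → ℂ) : ℂ :=
  (fderiv ℝ f z (Pi.single i 1) - Complex.I * fderiv ℝ f z (Pi.single i Complex.I)) / 2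

/-- The Wirtinger derivative `∂f/∂z̄_i = (∂f/∂x_i + √-1 ∂f/∂y_i) / 2`. -/
noncomputable def dzbar {n : ℕ} (i : Fin n) (f : (Fin n → ℂ) → ℂ) (z : Fin n → ℂ) : ℂ :=
  (fderiv ℝ f z (Pi.single i 1) + Complex.I * fderiv ℝ f z (Pi.single i Complex.I)) / 2

/-- The component matrix `g_{α β̄} = ∂² log K_G(z, z̄) / ∂z_α ∂z̄_β` of the Bergman metric of `G`. -/
noncomputable def bergmanMetric {n : ℕ} (G : Set (Fin n → ℂ)) (z : Fin n → ℂ) :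
    Matrix (Fin n) (Fin n) ℂ :=
  Matrix.of fun α β => dz α (dzbar β fun x => (Real.log (bergmanKernel G x) : ℂ)) z

/-- The curvature components of a Hermitian metric `g = (g_{a b̄})`,
`R_{a b̄ c d̄} = - ∂² g_{a b̄} / ∂z_c ∂z̄_d + ∑_{r,s} g^{s r̄} (∂g_{a r̄} / ∂z_c) (∂g_{s b̄} / ∂z̄_d)`,
where `∑_r g_{a r̄} g^{s r̄} = δ_{as}`, so that `g^{s r̄}` is the entry `(r, s)` of the matrix `g⁻¹`. -/
noncomputable def curvatureComponent {n : ℕ} (g : (Fin n → ℂ) → Matrix (Fin n) (Fin n) ℂ)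
    (a b c d : Fin n) (z : Fin n → ℂ) : ℂ :=
  -dz c (dzbar d fun x => g x a b) z +
    ∑ r, ∑ s, (g z)⁻¹ r s * dz c (fun x => g x a r) z * dzbar d (fun x => g x s b) z

/-- The holomorphic sectional curvature of `g` at `z` in the direction `ξ = ∑ ξ_i ∂/∂z_i`, normalized
as `h(ξ) = R(ξ, ξ̄, ξ, ξ̄) / g(ξ, ξ̄)²`. -/
noncomputable def holSecCurvature {n : ℕ} (g : (Fin n → ℂ) → Matrix (Fin n) (Fin n) ℂ)
    (z ξ : Fin n → ℂ) : ℂ :=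
  (∑ a, ∑ b, ∑ c, ∑ d, curvatureComponent g a b c d z *
      ξ a * starRingEnd ℂ (ξ b) * ξ c * starRingEnd ℂ (ξ d)) /
    (∑ a, ∑ b, g z a b * ξ a * starRingEnd ℂ (ξ b)) ^ 2

/-! The ellipsoid is a complete Reinhardt domain, so holomorphic functions on it expand in
monomials, and averaging over coordinate rotations makes the monomials orthogonal. Their norms are
beta integrals. After normalization, summing over the power of `z` is a binomial series and summing
over the power of `w` a rational generating function. With `s = |z|²` and `x = |w|² (1 - s)^(-1/p)`
this gives `π² K = (1 - s)^(-(1/p + 2)) (p + 1 - (p - 1) x) / (p (1 - x)³)`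
(`bergmanKernel_ellipsoid`). Since `bergmanKernel` is built from an arbitrarily chosen basis,
`hasSum_norm_sq_basis` shows that every basis gives the same sum.

On each slice `z = const` the potential `log K` is a function of `|w|²`, so `∂_w log K`, `∂_w̄ log
K` and `∂_w² log K` vanish on the axis `w = 0`. Differentiating these identities along the axis
makes the metric diagonal there and kills the off-diagonal terms of the curvature
(`curvatureComponent_diag_of_fin_two`). Both curvatures thus become one-variable computations with
radial functions. Along the axis, `g_{z z̄} = (1/p + 2)/(1 - s)²` is a multiple of the Poincaré
metric, of curvature `-2/(1/p + 2)`. Across it, `∂_w g_{w w̄} = 0` at `w = 0`, and only `-∂_w ∂_w̄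
g_{w w̄} / g_{w w̄}²` remains. The two values agree exactly when `(p - 1)² = 0`. -/

open scoped ContDiff

/-! ### Wirtinger calculus on coordinate slices, and curvature of a metric that is diagonal at a
point. -/

section Wirtinger

variable {n : ℕ}

lemma ContDiffOn.dz {f : (Fin n → ℂ) → ℂ} {U : Set (Fin n → ℂ)} (hU : IsOpen U)
    (hf : ContDiffOn ℝ ∞ f U) (i : Fin n) : ContDiffOn ℝ ∞ (dz i f) U := by
  have h : ContDiffOn ℝ ∞ (fderiv ℝ f) U := hf.fderiv_of_isOpen hU (by simp)
  unfold _root_.dz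
  exact ((h.clm_apply contDiffOn_const).sub
    (contDiffOn_const.mul (h.clm_apply contDiffOn_const))).div_const _

lemma ContDiffOn.dzbar {f : (Fin n → ℂ) → ℂ} {U : Set (Fin n → ℂ)} (hU : IsOpen U)
    (hf : ContDiffOn ℝ ∞ f U) (i : Fin n) : ContDiffOn ℝ ∞ (dzbar i f) U := by
  have h : ContDiffOn ℝ ∞ (fderiv ℝ f) U := hf.fderiv_of_isOpen hU (by simp)
  unfold _root_.dzbar
  exact ((h.clm_apply contDiffOn_const).add
    (contDiffOn_const.mul (h.clm_apply contDiffOn_const))).div_const _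

lemma Filter.EventuallyEq.dz_eq {f g : (Fin n → ℂ) → ℂ} {z : Fin n → ℂ} (h : f =ᶠ[nhds z] g)
    (i : Fin n) : dz i f z = dz i g z := by
  simp only [dz, h.fderiv_eq]

/-- Both sides are the same combination of four real second derivatives, up to the symmetry of the
second derivative. It serves to move a derivative tangent to the axis `w = 0` to the outside. -/
lemma dz_dzbar_comm {f : (Fin n → ℂ) → ℂ} {U : Set (Fin n → ℂ)} (hU : IsOpen U)
    (hf : ContDiffOn ℝ ∞ f U) (i j : Fin n) {z : Fin n → ℂ} (hz : z ∈ U) :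
    dz i (dzbar j f) z = dzbar j (dz i f) z := by
  have hfz : ContDiffAt ℝ ∞ f z := hf.contDiffAt (hU.mem_nhds hz)
  have hsymm : IsSymmSndFDerivAt ℝ f z :=
    hfz.isSymmSndFDerivAt (by simp; exact WithTop.coe_le_coe.2 (le_top : (2 : ℕ∞) ≤ ⊤))
  have h : DifferentiableAt ℝ (fderiv ℝ f) z :=
    (hfz.fderiv_right (m := 1) (by norm_cast)).differentiableAt (by simp)
  have key (v : Fin n → ℂ) : HasFDerivAt (fun x => fderiv ℝ f x v)
      ((fderiv ℝ (fderiv ℝ f) z).flip v) z := by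
    simpa using h.hasFDerivAt.clm_apply (hasFDerivAt_const v z)
  have e1 : HasFDerivAt (dzbar j f) _ z :=
    ((key (Pi.single j 1)).add ((key (Pi.single j Complex.I)).const_mul Complex.I)).mul_const
      (2 : ℂ)⁻¹
  have e2 : HasFDerivAt (dz i f) _ z :=
    ((key (Pi.single i 1)).sub ((key (Pi.single i Complex.I)).const_mul Complex.I)).mul_const
      (2 : ℂ)⁻¹
  rw [dz, dzbar, e1.fderiv, e2.fderiv]
  simp only [smul_apply, add_apply, sub_apply, ContinuousLinearMap.flip_apply, smul_eq_mul]
  rw [hsymm (Pi.single i 1) (Pi.single j 1), hsymm (Pi.single i 1) (Pi.single j Complex.I),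
    hsymm (Pi.single i Complex.I) (Pi.single j 1),
    hsymm (Pi.single i Complex.I) (Pi.single j Complex.I)]
  ring

/-- `φ` is real differentiable at `ζ` with `∂φ/∂ζ = a` and `∂φ/∂ζ̄ = b`. -/
def HasWirtingerDerivAt (φ : ℂ → ℂ) (a b ζ : ℂ) : Prop :=
  HasFDerivAt φ (a • (ContinuousLinearMap.id ℝ ℂ) + b • (Complex.conjCLE : ℂ →L[ℝ] ℂ)) ζ

namespace HasWirtingerDerivAt

variable {φ ψ : ℂ → ℂ} {a b c d ζ : ℂ}

lemma id : HasWirtingerDerivAt (fun ζ => ζ) 1 0 ζ := by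
  unfold HasWirtingerDerivAt
  exact (hasFDerivAt_id (𝕜 := ℝ) ζ).congr_fderiv (by simp)

lemma conj : HasWirtingerDerivAt (fun ζ => starRingEnd ℂ ζ) 0 1 ζ := by
  unfold HasWirtingerDerivAt
  exact ((Complex.conjCLE : ℂ →L[ℝ] ℂ).hasFDerivAt (x := ζ)).congr_fderiv (by simp)

lemma mul (h₁ : HasWirtingerDerivAt φ a b ζ) (h₂ : HasWirtingerDerivAt ψ c d ζ) :
    HasWirtingerDerivAt (fun ζ => φ ζ * ψ ζ) (φ ζ * c + a * ψ ζ) (φ ζ * d + b * ψ ζ) ζ := by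
  unfold HasWirtingerDerivAt at *
  refine (HasFDerivAt.mul h₁ h₂).congr_fderiv ?_
  ext
  simp
  ring

lemma comp_normSq {F : ℝ → ℝ} {F' : ℝ} (h : HasDerivAt F F' (Complex.normSq ζ)) :
    HasWirtingerDerivAt (fun ζ => (F (Complex.normSq ζ) : ℂ)) (F' * starRingEnd ℂ ζ) (F' * ζ) ζ := by
  have hre := Complex.reCLM.hasFDerivAt (x := ζ)
  have him := Complex.imCLM.hasFDerivAt (x := ζ)
  have hn : HasFDerivAt Complex.normSq _ ζ := (hre.mul hre).add (him.mul him)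
  have := Complex.ofRealCLM.hasFDerivAt.comp ζ (h.comp_hasFDerivAt ζ hn)
  refine this.congr_fderiv ?_
  ext v
  refine Complex.ext ?_ ?_ <;> simp <;> ring

/-- By the chain rule, real differentiability of `f` lets its restriction to one coordinate line
determine both Wirtinger derivatives in that coordinate. -/
lemma dz_eq {f : (Fin n → ℂ) → ℂ} {z : Fin n → ℂ} {i : Fin n} (hf : DifferentiableAt ℝ f z)
    (hφ : HasWirtingerDerivAt φ a b (z i))
    (h : (fun ζ => f (Function.update z i ζ)) =ᶠ[nhds (z i)] φ) :
    dz i f z = a ∧ dzbar i f z = b := by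
  have h1 : HasFDerivAt (fun ζ => f (Function.update z i ζ)) _ (z i) := hφ.congr_of_eventuallyEq h
  have hu : HasFDerivAt (fun ζ => Function.update z i ζ) _ (z i) :=
    (hasFDerivAt_update (𝕜 := ℝ) z (z i))
  have hf' : HasFDerivAt f (fderiv ℝ f z) (Function.update z i (z i)) := by
    simpa using hf.hasFDerivAt
  have h2 := hf'.comp (z i) hu
  have h3 := h1.unique h2
  have hs (v : ℂ) : fderiv ℝ f z (Pi.single i v) = a * v + b * starRingEnd ℂ v := by
    have := congrArg (fun L => L v) h3
    simp only [add_apply, smul_apply,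
      ContinuousLinearMap.comp_apply] at this
    rw [← show (ContinuousLinearMap.pi (Pi.single i (ContinuousLinearMap.id ℝ ℂ))) v
      = Pi.single (M := fun _ : Fin n => ℂ) i v from ?_]
    · simpa using this.symm
    · ext j
      rcases eq_or_ne j i with rfl | hj <;> simp [*]
  rw [dz, dzbar, hs, hs]
  have hI := Complex.I_mul_I
  constructor <;> simp only [map_one, Complex.conj_I]
  · linear_combination ((-a + b) / 2 : ℂ) * hI
  · linear_combination ((a - b) / 2 : ℂ) * hI

end HasWirtingerDerivAt


/-- The slice of `U` through `q` parallel to the `i`-th coordinate axis. -/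
def coordSlice (U : Set (Fin n → ℂ)) (q : Fin n → ℂ) (i : Fin n) : Set ℂ :=
  {ζ | Function.update q i ζ ∈ U}

lemma isOpen_coordSlice {U : Set (Fin n → ℂ)} (hU : IsOpen U) (q : Fin n → ℂ) (i : Fin n) :
    IsOpen (coordSlice U q i) :=
  hU.preimage (continuous_const.update i continuous_id)

section Slice

variable {U : Set (Fin n → ℂ)} {f : (Fin n → ℂ) → ℂ} {q : Fin n → ℂ} {i : Fin n}

lemma dz_slice (hU : IsOpen U) (hf : ContDiffOn ℝ ∞ f U) {φ a b : ℂ → ℂ}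
    (hφ : ∀ ζ ∈ coordSlice U q i, f (Function.update q i ζ) = φ ζ)
    (hd : ∀ ζ ∈ coordSlice U q i, HasWirtingerDerivAt φ (a ζ) (b ζ) ζ)
    {ζ : ℂ} (hζ : ζ ∈ coordSlice U q i) :
    dz i f (Function.update q i ζ) = a ζ ∧ dzbar i f (Function.update q i ζ) = b ζ := by
  have hfd : DifferentiableAt ℝ f (Function.update q i ζ) :=
    (hf.contDiffAt (hU.mem_nhds hζ)).differentiableAt (by simp)
  refine HasWirtingerDerivAt.dz_eq hfd (φ := φ) (by simpa using hd ζ hζ) ?_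
  simp only [Function.update_self, Function.update_idem]
  filter_upwards [(isOpen_coordSlice hU q i).mem_nhds hζ] with x hx using hφ x hx

lemma dz_slice_eq_zero (hU : IsOpen U) (hf : ContDiffOn ℝ ∞ f U)
    (h0 : ∀ ζ ∈ coordSlice U q i, f (Function.update q i ζ) = 0)
    {ζ : ℂ} (hζ : ζ ∈ coordSlice U q i) :
    dz i f (Function.update q i ζ) = 0 ∧ dzbar i f (Function.update q i ζ) = 0 :=
  dz_slice hU hf (φ := fun _ => 0) (a := fun _ => 0) (b := fun _ => 0) h0
    (fun ζ _ => (hasFDerivAt_const (𝕜 := ℝ) (0 : ℂ) ζ).congr_fderiv (by ext; simp)) hζ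

/-- Derivatives along a slice on which `f` is the radial function `F (|ζ|²)`. -/
lemma dz_radial (hU : IsOpen U) (hf : ContDiffOn ℝ ∞ f U) {F F₁ : ℝ → ℝ}
    (hF : ∀ ζ ∈ coordSlice U q i, f (Function.update q i ζ) = F (Complex.normSq ζ))
    (hF₁ : ∀ ζ ∈ coordSlice U q i, HasDerivAt F (F₁ (Complex.normSq ζ)) (Complex.normSq ζ))
    {ζ : ℂ} (hζ : ζ ∈ coordSlice U q i) :
    dz i f (Function.update q i ζ) = F₁ (Complex.normSq ζ) * starRingEnd ℂ ζ ∧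
      dzbar i f (Function.update q i ζ) = F₁ (Complex.normSq ζ) * ζ :=
  dz_slice hU hf hF (a := fun ζ => F₁ (Complex.normSq ζ) * starRingEnd ℂ ζ)
    (b := fun ζ => F₁ (Complex.normSq ζ) * ζ)
    (fun ζ hζ => HasWirtingerDerivAt.comp_normSq (hF₁ ζ hζ)) hζ

lemma dz_dzbar_radial (hU : IsOpen U) (hf : ContDiffOn ℝ ∞ f U) {F F₁ F₂ : ℝ → ℝ}
    (hF : ∀ ζ ∈ coordSlice U q i, f (Function.update q i ζ) = F (Complex.normSq ζ))
    (hF₁ : ∀ ζ ∈ coordSlice U q i, HasDerivAt F (F₁ (Complex.normSq ζ)) (Complex.normSq ζ))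
    (hF₂ : ∀ ζ ∈ coordSlice U q i, HasDerivAt F₁ (F₂ (Complex.normSq ζ)) (Complex.normSq ζ))
    {ζ : ℂ} (hζ : ζ ∈ coordSlice U q i) :
    -- For a radial function, `∂∂̄ F(|ζ|²) = F' + |ζ|² F''` and `∂² F(|ζ|²) = F'' ζ̄²`; the latter
    -- vanishes at `ζ = 0`.
    dz i (dzbar i f) (Function.update q i ζ) =
        ((F₁ (Complex.normSq ζ) + Complex.normSq ζ * F₂ (Complex.normSq ζ) : ℝ) : ℂ) ∧
      dz i (dz i f) (Function.update q i ζ) = F₂ (Complex.normSq ζ) * starRingEnd ℂ ζ ^ 2 := by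
  constructor
  · refine (dz_slice hU (hf.dzbar hU i) (φ := fun ζ => F₁ (Complex.normSq ζ) * ζ)
      (fun ζ hζ => (dz_radial hU hf hF hF₁ hζ).2)
      (fun ζ hζ => (HasWirtingerDerivAt.comp_normSq (hF₂ ζ hζ)).mul HasWirtingerDerivAt.id)
      hζ).1.trans ?_
    push_cast
    rw [Complex.normSq_eq_conj_mul_self]
    ring
  · refine (dz_slice hU (hf.dz hU i) (φ := fun ζ => F₁ (Complex.normSq ζ) * starRingEnd ℂ ζ)
      (fun ζ hζ => (dz_radial hU hf hF hF₁ hζ).1)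
      (fun ζ hζ => (HasWirtingerDerivAt.comp_normSq (hF₂ ζ hζ)).mul HasWirtingerDerivAt.conj)
      hζ).1.trans ?_
    ring

end Slice

/-- The inverse of a diagonal matrix is diagonal, so only the terms `r = s` of the correction
survive, and `hi` removes the one with `r ≠ i`. -/
lemma curvatureComponent_diag_of_fin_two (g : (Fin 2 → ℂ) → Matrix (Fin 2) (Fin 2) ℂ)
    (q : Fin 2 → ℂ) (h01 : g q 0 1 = 0) (h10 : g q 1 0 = 0) (h00 : g q 0 0 ≠ 0)
    (h11 : g q 1 1 ≠ 0) (i : Fin 2) (hi : ∀ j, j ≠ i → dz i (fun x => g x i j) q = 0) :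
    curvatureComponent g i i i i q = -dz i (dzbar i fun x => g x i i) q +
      (g q i i)⁻¹ * dz i (fun x => g x i i) q * dzbar i (fun x => g x i i) q := by
  have hdet : (g q).det = g q 0 0 * g q 1 1 := by rw [Matrix.det_fin_two, h01]; ring
  have hinv : (g q)⁻¹ = !![(g q 0 0)⁻¹, 0; 0, (g q 1 1)⁻¹] := by
    rw [Matrix.inv_def, hdet, Matrix.adjugate_fin_two, h01, h10]
    ext a b
    fin_cases a <;> fin_cases b <;> simp <;> field_simp
  rw [curvatureComponent, hinv]
  fin_cases i
  · have := hi 1 (by simp)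
    simp at this ⊢
    simp [this]
  · have := hi 0 (by simp)
    simp at this ⊢
    simp [this]

lemma holSecCurvature_single (g : (Fin 2 → ℂ) → Matrix (Fin 2) (Fin 2) ℂ) (q : Fin 2 → ℂ)
    (i : Fin 2) : holSecCurvature g q (Pi.single i 1) =
      curvatureComponent g i i i i q / (g q i i) ^ 2 := by
  fin_cases i <;> simp [holSecCurvature]

end Wirtinger

/-! ### Power series expansion of holomorphic functions on complete Reinhardt domains of `ℂ²`. -/

section PowerSeries

open Complex Metric Set

/-- The hypotheses of Osgood's lemma on a closed bidisc. -/
structure HolomorphicOnBidisc (f : ℂ → ℂ → ℂ) (r ρ : ℝ) : Prop where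
  cont : ContinuousOn (Function.uncurry f) (closedBall 0 r ×ˢ closedBall 0 ρ)
  left : ∀ w ∈ closedBall (0 : ℂ) ρ, DifferentiableOn ℂ (fun z => f z w) (closedBall 0 r)
  right : ∀ z ∈ closedBall (0 : ℂ) r, DifferentiableOn ℂ (f z) (closedBall 0 ρ)

/-- The `b`-th Taylor coefficient at `0` of a function of one variable. -/
noncomputable def taylorCoeff (g : ℂ → ℂ) (b : ℕ) : ℂ := (b.factorial : ℂ)⁻¹ * iteratedDeriv b g 0

lemma hasSum_taylorCoeff {g : ℂ → ℂ} {r : ℝ} (hg : DifferentiableOn ℂ g (ball 0 r)) {z : ℂ}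
    (hz : z ∈ ball (0 : ℂ) r) : HasSum (fun n => taylorCoeff g n * z ^ n) (g z) := by
  have h (n : ℕ) : taylorCoeff g n * z ^ n =
      (n.factorial : ℂ)⁻¹ • (z - 0) ^ n • iteratedDeriv n g 0 := by
    simp only [taylorCoeff, sub_zero, smul_eq_mul]
    ring
  simpa only [h] using hasSum_taylorSeries_on_ball hg hz

lemma norm_taylorCoeff_le {g : ℂ → ℂ} {r M : ℝ} (hr : 0 < r)
    (hg : DifferentiableOn ℂ g (closedBall 0 r)) (hM : ∀ z ∈ sphere (0 : ℂ) r, ‖g z‖ ≤ M) (n : ℕ) :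
    ‖taylorCoeff g n‖ ≤ M / r ^ n := by
  have h := norm_iteratedDeriv_le_of_forall_mem_sphere_norm_le n hr
    (hg.mono closure_ball_subset_closedBall).diffContOnCl hM
  have hn : (0 : ℝ) < n.factorial := by positivity
  rw [taylorCoeff, norm_mul, norm_inv, Complex.norm_natCast, inv_mul_le_iff₀ hn]
  exact h.trans_eq (by ring)

lemma taylorCoeff_eq_circleIntegral {g : ℂ → ℂ} {r : ℝ} (hr : 0 < r)
    (hg : DifferentiableOn ℂ g (closedBall 0 r)) (n : ℕ) :
    taylorCoeff g n = (2 * Real.pi * I)⁻¹ * ∮ w in C(0, r), (w ^ (n + 1))⁻¹ * g w := by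
  have h := hg.circleIntegral_one_div_sub_center_pow_smul hr n
  simp only [sub_zero, one_div, smul_eq_mul] at h
  rw [h, taylorCoeff]
  have : (2 * Real.pi * I : ℂ) ≠ 0 := two_pi_I_ne_zero
  field_simp

lemma circleIntegral_swap {F : ℂ → ℂ → ℂ} {r ρ : ℝ} (hr : 0 ≤ r) (hρ : 0 ≤ ρ)
    (hF : ContinuousOn (Function.uncurry F) (sphere 0 r ×ˢ sphere 0 ρ)) :
    ∮ z in C(0, r), ∮ w in C(0, ρ), F z w = ∮ w in C(0, ρ), ∮ z in C(0, r), F z w := by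
  have hc : Continuous fun x : ℝ × ℝ => F (circleMap 0 r x.1) (circleMap 0 ρ x.2) :=
    hF.comp_continuous (f := fun x : ℝ × ℝ => (circleMap 0 r x.1, circleMap 0 ρ x.2))
      (by fun_prop) fun x => ⟨circleMap_mem_sphere _ hr _, circleMap_mem_sphere _ hρ _⟩
  simp only [circleIntegral, ← intervalIntegral.integral_smul]
  rw [intervalIntegral_intervalIntegral_swap]
  · simp only [smul_eq_mul, mul_left_comm]
  · refine ContinuousOn.integrableOn_compact (isCompact_uIcc.prod isCompact_uIcc)
      (Continuous.continuousOn ?_) |>.mono_set (prod_mono uIoc_subset_uIcc uIoc_subset_uIcc)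
    simp only [Function.uncurry_def, deriv_circleMap]
    have h1 : Continuous fun x : ℝ × ℝ => circleMap 0 r x.1 * I := by fun_prop
    have h2 : Continuous fun x : ℝ × ℝ => circleMap 0 ρ x.2 * I := by fun_prop
    exact h1.smul (h2.smul hc)

lemma continuousOn_circleIntegral {F : ℂ → ℂ → ℂ} {r ρ : ℝ} (hρ : 0 ≤ ρ)
    (hF : ContinuousOn (Function.uncurry F) (sphere 0 r ×ˢ sphere 0 ρ)) :
    ContinuousOn (fun z => ∮ w in C(0, ρ), F z w) (sphere 0 r) := by
  rw [continuousOn_iff_continuous_domRestrict]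
  have hc : Continuous fun x : sphere (0 : ℂ) r × ℝ => F x.1 (circleMap 0 ρ x.2) :=
    hF.comp_continuous (f := fun x : sphere (0 : ℂ) r × ℝ => ((x.1 : ℂ), circleMap 0 ρ x.2))
      (by fun_prop) fun x => ⟨x.1.2, circleMap_mem_sphere _ hρ _⟩
  refine intervalIntegral.continuous_parametric_intervalIntegral_of_continuous' ?_ _ _
  simp only [Function.uncurry_def, deriv_circleMap]
  have h1 : Continuous fun x : sphere (0 : ℂ) r × ℝ => circleMap 0 ρ x.2 * I := by fun_prop
  exact h1.smul hc

namespace HolomorphicOnBidisc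

variable {f : ℂ → ℂ → ℂ} {r ρ : ℝ}

/-- The `b`-th coefficient in `w` is a circle integral of `f z w`. Inserting Cauchy's formula in `z`
and exchanging the two circle integrals shows that the coefficient is the Cauchy integral of its own
continuous boundary values, hence holomorphic in `z`. -/
lemma differentiableOn_taylorCoeff (hf : HolomorphicOnBidisc f r ρ) (hr : 0 < r) (hρ : 0 < ρ)
    (b : ℕ) : DifferentiableOn ℂ (fun z => taylorCoeff (f z) b) (ball 0 r) := by
  set G : ℂ → ℂ := fun z => taylorCoeff (f z) b with hG
  have hGz : ∀ z ∈ closedBall (0 : ℂ) r,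
      G z = (2 * Real.pi * I)⁻¹ * ∮ w in C(0, ρ), (w ^ (b + 1))⁻¹ * f z w :=
    fun z hz => taylorCoeff_eq_circleIntegral hρ (hf.right z hz) b
  have hsub : sphere (0 : ℂ) r ×ˢ sphere (0 : ℂ) ρ ⊆ closedBall 0 r ×ˢ closedBall 0 ρ :=
    prod_mono sphere_subset_closedBall sphere_subset_closedBall
  have hinv : ContinuousOn (fun x : ℂ × ℂ => (x.2 ^ (b + 1))⁻¹)
      (sphere (0 : ℂ) r ×ˢ sphere (0 : ℂ) ρ) :=
    ContinuousOn.inv₀ (by fun_prop) fun x hx => pow_ne_zero _ (ne_of_mem_sphere hx.2 hρ.ne')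
  have hcont : ContinuousOn (Function.uncurry fun z w => (w ^ (b + 1))⁻¹ * f z w)
      (sphere (0 : ℂ) r ×ˢ sphere (0 : ℂ) ρ) := hinv.mul (hf.cont.mono hsub)
  have hGc : ContinuousOn G (sphere 0 r) :=
    ((continuousOn_circleIntegral hρ.le hcont).const_mul _).congr
      fun z hz => hGz z (sphere_subset_closedBall hz)
  have hcauchy : ∀ z ∈ ball (0 : ℂ) r,
      G z = (2 * Real.pi * I)⁻¹ • ∮ ζ in C(0, r), (ζ - z)⁻¹ • G ζ := by
    intro z hz
    have h1 : ∀ w ∈ sphere (0 : ℂ) ρ,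
        f z w = (2 * Real.pi * I)⁻¹ * ∮ ζ in C(0, r), (ζ - z)⁻¹ * f ζ w := fun w hw => by
      have := (hf.left w (sphere_subset_closedBall hw)).circleIntegral_sub_inv_smul hz
      simp only [smul_eq_mul] at this
      rw [this, inv_mul_cancel_left₀ two_pi_I_ne_zero]
    have h2 : ContinuousOn (Function.uncurry fun ζ w => (ζ - z)⁻¹ * ((w ^ (b + 1))⁻¹ * f ζ w))
        (sphere (0 : ℂ) r ×ˢ sphere (0 : ℂ) ρ) := by
      refine ContinuousOn.mul (f := fun x : ℂ × ℂ => (x.1 - z)⁻¹)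
        (ContinuousOn.inv₀ (by fun_prop) ?_) hcont
      rintro x ⟨hx, -⟩ h0
      rw [sub_eq_zero] at h0
      rw [mem_sphere, h0] at hx
      exact (mem_ball.1 hz).ne hx
    rw [hGz z (ball_subset_closedBall hz), smul_eq_mul]
    congr 1
    rw [circleIntegral.integral_congr (g := fun ζ => (2 * Real.pi * I)⁻¹ *
      ∮ w in C(0, ρ), (ζ - z)⁻¹ * ((w ^ (b + 1))⁻¹ * f ζ w)) hr.le]
    · rw [circleIntegral.integral_const_mul, circleIntegral_swap hr.le hρ.le h2,
        ← circleIntegral.integral_const_mul]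
      refine circleIntegral.integral_congr hρ.le fun w hw => ?_
      rw [h1 w hw, mul_left_comm, ← circleIntegral.integral_const_mul]
      simp only [mul_left_comm]
    · intro ζ hζ
      beta_reduce
      rw [hGz ζ (sphere_subset_closedBall hζ), circleIntegral.integral_const_mul, smul_eq_mul]
      ring
  lift r to NNReal using hr.le
  have hps := hasFPowerSeriesOn_cauchy_integral (hGc.circleIntegrable hr.le) (by exact_mod_cast hr)
  have := hps.differentiableOn
  rw [Metric.eball_coe] at this
  exact this.congr hcauchy

lemma hasSum (hf : HolomorphicOnBidisc f r ρ) (hr : 0 < r) (hρ : 0 < ρ) {z w : ℂ} (hz : ‖z‖ < r)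
    (hw : ‖w‖ < ρ) :
    HasSum (fun α : ℕ × ℕ => taylorCoeff (fun z => taylorCoeff (f z) α.2) α.1 *
      (z ^ α.1 * w ^ α.2)) (f z w) := by
  set c : ℕ × ℕ → ℂ := fun α => taylorCoeff (fun z => taylorCoeff (f z) α.2) α.1 with hc
  obtain ⟨M, hM⟩ := ((isCompact_closedBall (0 : ℂ) r).prod
    (isCompact_closedBall (0 : ℂ) ρ)).exists_bound_of_continuousOn hf.cont
  -- The coefficient functions are known to be holomorphic only on the open disc of radius `r`, so
  -- the Cauchy estimate in `z` is taken on a slightly smaller circle.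
  obtain ⟨r', hzr, hr'⟩ := exists_between hz
  have hr'0 : 0 < r' := (norm_nonneg z).trans_lt hzr
  have hd := hf.differentiableOn_taylorCoeff hr hρ
  have hg : ∀ b, ∀ ζ ∈ closedBall (0 : ℂ) r, ‖taylorCoeff (f ζ) b‖ ≤ M / ρ ^ b := fun b ζ hζ =>
    norm_taylorCoeff_le hρ (hf.right ζ hζ) (fun w hw => hM (ζ, w) ⟨hζ, sphere_subset_closedBall hw⟩) b
  have hcb : ∀ α, ‖c α‖ ≤ M / ρ ^ α.2 / r' ^ α.1 := fun α =>
    norm_taylorCoeff_le hr'0 ((hd α.2).mono (closedBall_subset_ball hr'))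
      (fun ζ hζ => hg _ _ ((sphere_subset_closedBall.trans (closedBall_subset_closedBall hr'.le)) hζ))
      α.1
  -- The two Cauchy estimates dominate the double series by a product of geometric series; absolute
  -- convergence then permits summing over the power of `z` first.
  have hs : Summable fun α : ℕ × ℕ => c α * (z ^ α.1 * w ^ α.2) := by
    have h1 : Summable fun a : ℕ => (‖z‖ / r') ^ a :=
      summable_geometric_of_lt_one (by positivity) ((div_lt_one hr'0).2 hzr)
    have h2 : Summable fun b : ℕ => (‖w‖ / ρ) ^ b :=
      summable_geometric_of_lt_one (by positivity) ((div_lt_one hρ).2 hw)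
    refine Summable.of_norm_bounded ((h1.mul_of_nonneg h2 (fun a => by positivity)
      (fun b => by positivity)).mul_left M) fun α => ?_
    rw [norm_mul, norm_mul, norm_pow, norm_pow]
    refine (mul_le_mul_of_nonneg_right (hcb α) (by positivity)).trans_eq ?_
    rw [div_pow, div_pow]
    field_simp
  have hz' : z ∈ ball (0 : ℂ) r := by simpa using hz
  have hw' : w ∈ ball (0 : ℂ) ρ := by simpa using hw
  have h3 : HasSum (fun b => taylorCoeff (f z) b * w ^ b) _ :=
    ((Equiv.prodComm ℕ ℕ).hasSum_iff.2 hs.hasSum).prod_fiberwise fun b => by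
      refine ((hasSum_taylorCoeff (hd b) hz').mul_right (w ^ b)).congr_fun ?_
      intro a
      simp [hc, mul_assoc]
  have h4 := hasSum_taylorCoeff ((hf.right z (ball_subset_closedBall hz')).mono
    ball_subset_closedBall) hw'
  exact h3.unique h4 ▸ hs.hasSum

end HolomorphicOnBidisc

/-- Complete Reinhardt sets of `ℂⁿ`. -/
def IsCompleteReinhardt {n : ℕ} (G : Set (Fin n → ℂ)) : Prop :=
  ∀ q ∈ G, ∀ q' : Fin n → ℂ, (∀ i, ‖q' i‖ ≤ ‖q i‖) → q' ∈ G

/-- The monomial `z^a w^b`, for `α = (a, b)`. -/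
def monomialFun (α : ℕ × ℕ) (q : Fin 2 → ℂ) : ℂ := q 0 ^ α.1 * q 1 ^ α.2

lemma differentiable_monomialFun (α : ℕ × ℕ) : Differentiable ℂ (monomialFun α) := by
  unfold monomialFun
  fun_prop

/-- Openness and completeness put a closed bidisc of radii slightly larger than `‖q 0‖`, `‖q 1‖`
inside `G`. The coefficients are Taylor coefficients at the origin, so the same family serves every
`q`. -/
theorem exists_hasSum_monomialFun {G : Set (Fin 2 → ℂ)} (hG : IsOpen G)
    (hR : IsCompleteReinhardt G) {f : (Fin 2 → ℂ) → ℂ} (hf : DifferentiableOn ℂ f G) :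
    ∃ c : ℕ × ℕ → ℂ, ∀ q ∈ G, HasSum (fun α => c α * monomialFun α q) (f q) := by
  refine ⟨fun α => taylorCoeff (fun z => taylorCoeff (fun w => f ![z, w]) α.2) α.1,
    fun q hq => ?_⟩
  have hq' : ![(‖q 0‖ : ℂ), (‖q 1‖ : ℂ)] ∈ G := hR q hq _ fun i => by
    fin_cases i <;> simp
  have hcont : Continuous fun t : ℝ => ![((‖q 0‖ + t : ℝ) : ℂ), ((‖q 1‖ + t : ℝ) : ℂ)] := by
    refine continuous_pi fun i => ?_
    fin_cases i <;> simp <;> fun_prop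
  obtain ⟨t, htG, ht⟩ : ∃ t : ℝ, ![((‖q 0‖ + t : ℝ) : ℂ), ((‖q 1‖ + t : ℝ) : ℂ)] ∈ G ∧ 0 < t := by
    have h0 : ∀ᶠ t in nhds (0 : ℝ), ![((‖q 0‖ + t : ℝ) : ℂ), ((‖q 1‖ + t : ℝ) : ℂ)] ∈ G :=
      hcont.continuousAt.eventually_mem (hG.mem_nhds (by simpa using hq'))
    exact ((h0.filter_mono nhdsWithin_le_nhds).and
      (self_mem_nhdsWithin (s := Ioi (0 : ℝ)))).exists
  have hsub : ∀ z ∈ closedBall (0 : ℂ) (‖q 0‖ + t), ∀ w ∈ closedBall (0 : ℂ) (‖q 1‖ + t),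
      ![z, w] ∈ G := fun z hz w hw => hR _ htG _ fun i => by
    have h0 : 0 ≤ ‖q 0‖ + t := by positivity
    have h1 : 0 ≤ ‖q 1‖ + t := by positivity
    fin_cases i
    · simpa [-ofReal_add, abs_of_nonneg h0] using hz
    · simpa [-ofReal_add, abs_of_nonneg h1] using hw
  have hbi : HolomorphicOnBidisc (fun z w => f ![z, w]) (‖q 0‖ + t) (‖q 1‖ + t) :=
    { cont := hf.continuousOn.comp (f := fun x : ℂ × ℂ => ![x.1, x.2])
        (Continuous.continuousOn (continuous_pi fun i => by fin_cases i <;> simp <;> fun_prop))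
        fun x hx => hsub x.1 hx.1 x.2 hx.2
      left := fun w hw => hf.comp (f := fun z => ![z, w])
        (Differentiable.differentiableOn (differentiable_pi.2 fun i => by
          fin_cases i <;> simp)) fun z hz => hsub z hz w hw
      right := fun z hz => hf.comp (f := fun w => ![z, w])
        (Differentiable.differentiableOn (differentiable_pi.2 fun i => by
          fin_cases i <;> simp)) fun w hw => hsub z hz w hw }
  have := hbi.hasSum (by positivity) (by positivity) (z := q 0) (w := q 1) (by linarith)
    (by linarith)
  have hqq : ![q 0, q 1] = q := by ext i; fin_cases i <;> rfl
  simpa only [hqq, monomialFun] using this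

end PowerSeries

/-! ### Parseval's identity for monomial series, by averaging over the torus. -/

section Parseval

open Set
open scoped ENNReal

lemma Orthonormal.hasSum_norm_sq {ι 𝕜 H : Type*} [RCLike 𝕜] [NormedAddCommGroup H]
    [InnerProductSpace 𝕜 H] {e : ι → H} (he : Orthonormal 𝕜 e) {d : ι → 𝕜} {x : H}
    (h : HasSum (fun i => d i • e i) x) : HasSum (fun i => ‖d i‖ ^ 2) (‖x‖ ^ 2) := by
  have h1 : Filter.Tendsto (fun s : Finset ι => ‖∑ i ∈ s, d i • e i‖ ^ 2) Filter.atTop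
      (nhds (‖x‖ ^ 2)) := (Filter.Tendsto.norm h).pow 2
  refine h1.congr fun s => ?_
  rw [← inner_self_eq_norm_sq (𝕜 := 𝕜), he.inner_sum, map_sum]
  refine Finset.sum_congr rfl fun i _ => ?_
  rw [RCLike.conj_mul]
  norm_cast

lemma eLpNorm_two_sq {X : Type*} [MeasurableSpace X] {μ : Measure X} (f : X → ℂ) :
    eLpNorm f 2 μ ^ 2 = ∫⁻ x, ‖f x‖ₑ ^ 2 ∂μ := by
  have := eLpNorm_nnreal_pow_eq_lintegral (f := f) (μ := μ) (p := 2) (by norm_num)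
  simpa using this

/-- The torus `(ℝ/ℤ)²`. -/
abbrev Torus₂ : Type := UnitAddCircle × UnitAddCircle

/-- The normalized Haar measure of the torus. -/
noncomputable abbrev torusMeasure : Measure Torus₂ :=
  (AddCircle.haarAddCircle : Measure UnitAddCircle).prod AddCircle.haarAddCircle

/-- The character `(s, t) ↦ exp (2πi (a s + b t))`, for `α = (a, b)`. -/
noncomputable def torusChar (α : ℕ × ℕ) : C(Torus₂, ℂ) where
  toFun t := fourier α.1 t.1 * fourier α.2 t.2
  continuous_toFun := by fun_prop

lemma norm_torusChar_apply (α : ℕ × ℕ) (t : Torus₂) : ‖torusChar α t‖ = 1 := by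
  simp [torusChar, fourier_apply, Circle.norm_coe]

lemma integral_fourier_mul_conj (m n : ℤ) :
    ∫ t : UnitAddCircle, fourier m t * starRingEnd ℂ (fourier n t) ∂AddCircle.haarAddCircle =
      if m = n then 1 else 0 := by
  have h := orthonormal_iff_ite.1 (orthonormal_fourier (T := 1)) n m
  simp only [ContinuousMap.inner_toLp] at h
  rw [h]
  simp only [eq_comm]

lemma orthonormal_torusChar :
    Orthonormal ℂ fun α => ContinuousMap.toLp (E := ℂ) 2 torusMeasure ℂ (torusChar α) := by
  rw [orthonormal_iff_ite]
  intro α β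
  rw [ContinuousMap.inner_toLp]
  have h : ∀ t : Torus₂, torusChar β t * starRingEnd ℂ (torusChar α t) =
      (fourier β.1 t.1 * starRingEnd ℂ (fourier α.1 t.1)) *
        (fourier β.2 t.2 * starRingEnd ℂ (fourier α.2 t.2)) := fun t => by
    simp only [torusChar, ContinuousMap.coe_mk, map_mul]
    ring
  simp only [h]
  rw [integral_prod_mul (fun t => fourier (β.1 : ℤ) t * starRingEnd ℂ (fourier (α.1 : ℤ) t))
    (fun t => fourier (β.2 : ℤ) t * starRingEnd ℂ (fourier (α.2 : ℤ) t)),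
    integral_fourier_mul_conj, integral_fourier_mul_conj]
  simp only [Nat.cast_inj, Prod.ext_iff, ite_and, eq_comm (a := α.1), eq_comm (a := α.2)]
  split_ifs <;> simp

/-- Parseval's identity for a series of continuous unimodular orthonormal functions that converges
unconditionally at every point. -/
lemma lintegral_enorm_sq_of_hasSum_orthonormal {T ι : Type*} [TopologicalSpace T] [CompactSpace T]
    [Nonempty T] [MeasurableSpace T] [BorelSpace T] {μ : Measure T} [IsFiniteMeasure μ]
    {χ : ι → C(T, ℂ)} (hχ : ∀ i t, ‖χ i t‖ = 1)
    (ho : Orthonormal ℂ fun i => ContinuousMap.toLp (E := ℂ) 2 μ ℂ (χ i)) {d : ι → ℂ} {F : T → ℂ}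
    (hF : ∀ t, HasSum (fun i => d i * χ i t) (F t)) :
    ∫⁻ t, ‖F t‖ₑ ^ 2 ∂μ = ∑' i, ‖d i‖ₑ ^ 2 := by
  -- Unconditional convergence at a single point is absolute convergence there, and the `χ i` are
  -- unimodular; so the series converges in the sup norm, and therefore in `L²`.
  have hd : Summable fun i => ‖d i‖ := by
    have := (hF (Classical.arbitrary T)).summable.norm
    simpa only [norm_mul, hχ, mul_one] using this
  have hs : Summable fun i => d i • χ i := Summable.of_norm_bounded hd fun i =>
    (norm_smul_le _ _).trans (mul_le_of_le_one_right (norm_nonneg _)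
      ((ContinuousMap.norm_le _ zero_le_one).2 fun t => (hχ i t).le))
  obtain ⟨S, hS⟩ := hs
  have hSF : ⇑S = F := funext fun t =>
    ((ContinuousMap.evalCLM ℂ t).hasSum hS).unique (by simpa using hF t)
  have h1 : HasSum (fun i => ‖d i‖ ^ 2) (‖ContinuousMap.toLp (E := ℂ) 2 μ ℂ S‖ ^ 2) :=
    ho.hasSum_norm_sq (by simpa using (ContinuousMap.toLp (E := ℂ) 2 μ ℂ).hasSum hS)
  have h2 : ‖ContinuousMap.toLp (E := ℂ) 2 μ ℂ S‖ₑ ^ 2 = ∑' i, ‖d i‖ₑ ^ 2 := by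
    have h3 := congrArg ENNReal.ofReal h1.tsum_eq
    rw [ENNReal.ofReal_tsum_of_nonneg (fun _ => by positivity) h1.summable,
      ENNReal.ofReal_pow (norm_nonneg _), ofReal_norm] at h3
    rw [← h3]
    refine tsum_congr fun i => ?_
    rw [ENNReal.ofReal_pow (norm_nonneg _), ofReal_norm]
  rw [← h2, Lp.enorm_def, eLpNorm_two_sq, ← hSF]
  refine lintegral_congr_ae ?_
  filter_upwards [ContinuousMap.coeFn_toLp (E := ℂ) (p := 2) (𝕜 := ℂ) μ S] with t ht
  rw [ht]

/-- The action of the torus on `ℂ²` by rotations of the coordinates. -/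
noncomputable def torusRotation (t : Torus₂) (q : Fin 2 → ℂ) : Fin 2 → ℂ :=
  fun i => (AddCircle.toCircle (![t.1, t.2] i) : ℂ) * q i

lemma norm_torusRotation (t : Torus₂) (q : Fin 2 → ℂ) (i : Fin 2) :
    ‖torusRotation t q i‖ = ‖q i‖ := by
  simp [torusRotation, Circle.norm_coe]

lemma continuous_torusRotation : Continuous fun x : Torus₂ × (Fin 2 → ℂ) =>
    torusRotation x.1 x.2 := by
  refine continuous_pi fun i => ?_
  fin_cases i
  · exact ((continuous_subtype_val.comp AddCircle.continuous_toCircle).comp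
      (continuous_fst.comp continuous_fst)).mul ((continuous_apply 0).comp continuous_snd)
  · exact ((continuous_subtype_val.comp AddCircle.continuous_toCircle).comp
      (continuous_snd.comp continuous_fst)).mul ((continuous_apply 1).comp continuous_snd)

lemma measurePreserving_torusRotation (t : Torus₂) :
    MeasurePreserving (torusRotation t) :=
  volume_preserving_pi fun i =>
    (rotation (AddCircle.toCircle (![t.1, t.2] i))).measurePreserving

lemma monomialFun_torusRotation (α : ℕ × ℕ) (t : Torus₂) (q : Fin 2 → ℂ) :
    monomialFun α (torusRotation t q) = monomialFun α q * torusChar α t := by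
  simp [monomialFun, torusRotation, torusChar, fourier_apply, AddCircle.toCircle_nsmul, mul_pow]
  ring

/-- Rotations preserve `G` and Lebesgue measure, so `|f|²` may be replaced by its average over the
torus. At fixed `q` the function `t ↦ f (torusRotation t q)` has Fourier coefficients `c α *
monomialFun α q`. All integrands are nonnegative, so no integrability of `f` is needed. -/
theorem lintegral_enorm_sq_eq_tsum {G : Set (Fin 2 → ℂ)} (hG : IsOpen G)
    (hR : IsCompleteReinhardt G) {f : (Fin 2 → ℂ) → ℂ} (hf : ContinuousOn f G)
    {c : ℕ × ℕ → ℂ} (hc : ∀ q ∈ G, HasSum (fun α => c α * monomialFun α q) (f q)) :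
    ∫⁻ q in G, ‖f q‖ₑ ^ 2 = ∑' α, ‖c α‖ₑ ^ 2 * ∫⁻ q in G, ‖monomialFun α q‖ₑ ^ 2 := by
  have hGm := hG.measurableSet
  have hrot : ∀ t q, torusRotation t q ∈ G ↔ q ∈ G := fun t q =>
    ⟨fun h => hR _ h _ fun i => (norm_torusRotation t q i).ge,
      fun h => hR _ h _ fun i => (norm_torusRotation t q i).le⟩
  set h : (Fin 2 → ℂ) → ℝ≥0∞ := G.indicator fun q => ‖f q‖ₑ ^ 2 with hh
  have hmeas : Measurable h := by
    classical
    exact ContinuousOn.measurable_piecewise (g := fun _ => 0)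
      ((ENNReal.continuous_pow 2).comp_continuousOn hf.enorm) continuousOn_const hGm
  have havg : ∀ q, ∫⁻ t, h (torusRotation t q) ∂torusMeasure =
      G.indicator (fun q => ∑' α, ‖c α‖ₑ ^ 2 * ‖monomialFun α q‖ₑ ^ 2) q := by
    intro q
    by_cases hq : q ∈ G
    · simp only [hh, Set.indicator, hrot, hq, if_true]
      rw [lintegral_enorm_sq_of_hasSum_orthonormal norm_torusChar_apply
        orthonormal_torusChar (d := fun α => c α * monomialFun α q)]
      · simp only [enorm_mul, mul_pow]
      · intro t
        simpa only [monomialFun_torusRotation, mul_assoc] using hc _ ((hrot t q).2 hq)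
    · simp [hh, Set.indicator, hrot, hq]
  have hjoint : Measurable (Function.uncurry fun t q => h (torusRotation t q)) :=
    hmeas.comp continuous_torusRotation.measurable
  calc ∫⁻ q in G, ‖f q‖ₑ ^ 2 = ∫⁻ q, h q := (lintegral_indicator hGm _).symm
    _ = ∫⁻ _t : Torus₂, (∫⁻ q, h q) ∂torusMeasure := by simp
    _ = ∫⁻ t, (∫⁻ q, h (torusRotation t q)) ∂torusMeasure :=
      lintegral_congr fun t => ((measurePreserving_torusRotation t).lintegral_comp hmeas).symm
    _ = ∫⁻ q, (∫⁻ t, h (torusRotation t q) ∂torusMeasure) :=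
      lintegral_lintegral_swap hjoint.aemeasurable
    _ = ∫⁻ q in G, ∑' α, ‖c α‖ₑ ^ 2 * ‖monomialFun α q‖ₑ ^ 2 := by
      simp only [havg, lintegral_indicator hGm]
    _ = ∑' α, ‖c α‖ₑ ^ 2 * ∫⁻ q in G, ‖monomialFun α q‖ₑ ^ 2 := by
      have hm : ∀ α, Measurable fun q => ‖monomialFun α q‖ₑ ^ 2 := fun α =>
        (differentiable_monomialFun α).continuous.measurable.enorm.pow_const 2
      rw [lintegral_tsum fun α => ((hm α).const_mul _).aemeasurable]
      exact tsum_congr fun α => lintegral_const_mul _ (hm α)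

end Parseval

/-! ### The Bergman space of a Reinhardt domain: monomial basis and independence of the kernel from
the basis. -/

section Kernel

open Set
open scoped ENNReal

section Hilbert

variable {ι 𝕜 H : Type*} [RCLike 𝕜] [NormedAddCommGroup H] [InnerProductSpace 𝕜 H]

lemma Orthonormal.inner_eq_of_hasSum {e : ι → H} (he : Orthonormal 𝕜 e) {d : ι → 𝕜} {x : H}
    (h : HasSum (fun i => d i • e i) x) (i : ι) : inner 𝕜 (e i) x = d i := by
  classical
  have h1 := (innerSL 𝕜 (e i)).hasSum h
  refine h1.unique ?_
  convert hasSum_ite_eq i (d i) using 2 with j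
  simp only [map_smul, innerSL_apply_apply, smul_eq_mul,
    orthonormal_iff_ite.1 he, mul_ite, mul_one, mul_zero]
  by_cases hij : i = j
  · simp [hij]
  · simp [hij, Ne.symm hij]

lemma Orthonormal.exists_hasSum_of_mem_closure [CompleteSpace H] {e : ι → H}
    (he : Orthonormal 𝕜 e) {x : H}
    (hx : x ∈ (Submodule.span 𝕜 (range e)).topologicalClosure) :
    ∃ d : ι → 𝕜, HasSum (fun i => d i • e i) x := by
  have hV := he.orthogonalFamily
  have hx' : x ∈ LinearMap.range hV.linearIsometry.toLinearMap := by
    rw [hV.range_linearIsometry]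
    refine Submodule.topologicalClosure_mono (Submodule.span_le.2 ?_) hx
    rintro _ ⟨i, rfl⟩
    exact Submodule.mem_iSup_of_mem i ⟨1, by simp⟩
  obtain ⟨f, rfl⟩ := hx'
  exact ⟨f, by simpa using hV.hasSum_linearIsometry f⟩

lemma Orthonormal.summable_smul [CompleteSpace H] {e : ι → H} (he : Orthonormal 𝕜 e) {d : ι → 𝕜}
    (hd : Summable fun i => ‖d i‖ ^ 2) : Summable fun i => d i • e i := by
  simpa using (he.orthogonalFamily.summable_iff_norm_sq_summable d).2 hd

lemma inner_eq_zero_of_norm_add_smul_sq {x y : H}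
    (h : ∀ b : 𝕜, ‖x + b • y‖ ^ 2 = ‖x‖ ^ 2 + ‖b‖ ^ 2 * ‖y‖ ^ 2) : inner 𝕜 x y = 0 := by
  -- With this `b` the cross term of the expanded square is `2 |⟨x, y⟩|²`, and the hypothesis makes
  -- it vanish.
  have h1 := h (starRingEnd 𝕜 (inner 𝕜 x y))
  rw [norm_add_sq (𝕜 := 𝕜), inner_smul_right, RCLike.conj_mul, norm_smul, mul_pow] at h1
  have h2 : ((‖inner 𝕜 x y‖ : 𝕜) ^ 2) = ((‖inner 𝕜 x y‖ ^ 2 : ℝ) : 𝕜) := by push_cast; rfl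
  rw [h2, RCLike.ofReal_re] at h1
  have h3 : ‖inner 𝕜 x y‖ ^ 2 = 0 := by linarith
  simpa using h3

end Hilbert

lemma inner_toLp_eq_integral {X : Type*} [MeasurableSpace X] {μ : Measure X} {f g : X → ℂ}
    (hf : MemLp f 2 μ) (hg : MemLp g 2 μ) :
    inner ℂ (hg.toLp g) (hf.toLp f) = ∫ x, f x * starRingEnd ℂ (g x) ∂μ := by
  rw [L2.inner_def]
  refine integral_congr_ae ?_
  filter_upwards [hf.coeFn_toLp, hg.coeFn_toLp] with x h1 h2
  rw [h1, h2, RCLike.inner_apply]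

lemma enorm_toLp_sq {X : Type*} [MeasurableSpace X] {μ : Measure X} {f : X → ℂ}
    (hf : MemLp f 2 μ) : ‖hf.toLp f‖ₑ ^ 2 = ∫⁻ x, ‖f x‖ₑ ^ 2 ∂μ := by
  rw [Lp.enorm_toLp, eLpNorm_two_sq]

lemma sum_smul_toLp {X ι : Type*} [MeasurableSpace X] {μ : Measure X} {f : ι → X → ℂ}
    (hf : ∀ i, MemLp (f i) 2 μ) (c : ι → ℂ) (s : Finset ι)
    (hm : MemLp (fun x => ∑ i ∈ s, c i * f i x) 2 μ) :
    ∑ i ∈ s, c i • (hf i).toLp (f i) = hm.toLp _ := by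
  classical
  induction s using Finset.induction_on with
  | empty =>
    simp only [Finset.sum_empty]
    refine (Lp.eq_zero_iff_ae_eq_zero.2 ?_).symm
    filter_upwards [hm.coeFn_toLp] with x hx
    simpa using hx
  | insert a s ha ih =>
    have h1 : (fun x => ∑ i ∈ insert a s, c i * f i x) =
        c a • f a + fun x => ∑ i ∈ s, c i * f i x := by
      ext x
      simp [Finset.sum_insert ha]
    have hm' : MemLp (fun x => ∑ i ∈ s, c i * f i x) 2 μ :=
      memLp_finsetSum _ fun i _ => (hf i).const_mul _
    rw [Finset.sum_insert ha, ih hm']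
    simp only [h1]
    rfl

variable {G : Set (Fin 2 → ℂ)} {N : ℕ × ℕ → ℝ}

/-- The monomials, normalized by the squares `N` of their norms. -/
noncomputable def normalizedMonomial (N : ℕ × ℕ → ℝ) (α : ℕ × ℕ) (q : Fin 2 → ℂ) : ℂ :=
  ((√(N α))⁻¹ : ℝ) * monomialFun α q

lemma norm_normalizedMonomial_sq (hN : ∀ α, 0 < N α) (α : ℕ × ℕ) (q : Fin 2 → ℂ) :
    ‖normalizedMonomial N α q‖ ^ 2 = (N α)⁻¹ * (‖q 0‖ ^ 2) ^ α.1 * (‖q 1‖ ^ 2) ^ α.2 := by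
  rw [normalizedMonomial, monomialFun, norm_mul, mul_pow, Complex.norm_real, Real.norm_eq_abs,
    sq_abs, inv_pow, Real.sq_sqrt (hN α).le, norm_mul, norm_pow, norm_pow, mul_pow, ← pow_mul,
    ← pow_mul, ← pow_mul, ← pow_mul, mul_comm 2, mul_comm 2, mul_assoc]

/-- `G` is an open complete Reinhardt set on which the monomials are square integrable with
squared norms `N`. -/
structure IsReinhardtWithNorms (G : Set (Fin 2 → ℂ)) (N : ℕ × ℕ → ℝ) : Prop where
  isOpen : IsOpen G
  reinhardt : IsCompleteReinhardt G
  pos : ∀ α, 0 < N α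
  norms : ∀ α, ∫⁻ q in G, ‖monomialFun α q‖ₑ ^ 2 = ENNReal.ofReal (N α)

namespace IsReinhardtWithNorms

lemma lintegral_enorm_sq (h : IsReinhardtWithNorms G N) {f : (Fin 2 → ℂ) → ℂ}
    (hf : ContinuousOn f G) {c : ℕ × ℕ → ℂ}
    (hc : ∀ q ∈ G, HasSum (fun α => c α * normalizedMonomial N α q) (f q)) :
    ∫⁻ q in G, ‖f q‖ₑ ^ 2 = ∑' α, ‖c α‖ₑ ^ 2 := by
  rw [lintegral_enorm_sq_eq_tsum h.isOpen h.reinhardt hf (c := fun α => c α * ((√(N α))⁻¹ : ℝ))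
    fun q hq => by simpa only [normalizedMonomial, mul_assoc] using hc q hq]
  refine tsum_congr fun α => ?_
  have hs : 0 ≤ (√(N α))⁻¹ := by positivity
  rw [h.norms, enorm_mul, mul_pow, mul_assoc, ← ofReal_norm, ← ofReal_norm,
    Complex.norm_real, Real.norm_of_nonneg hs, ← ENNReal.ofReal_pow hs,
    ← ENNReal.ofReal_mul (by positivity), inv_pow, Real.sq_sqrt (h.pos α).le,
    inv_mul_cancel₀ (h.pos α).ne', ENNReal.ofReal_one, mul_one]

lemma continuous_normalizedMonomial (α : ℕ × ℕ) : Continuous (normalizedMonomial N α) :=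
  continuous_const.mul (differentiable_monomialFun α).continuous

lemma differentiable_normalizedMonomial (α : ℕ × ℕ) :
    Differentiable ℂ (normalizedMonomial N α) :=
  (differentiable_const _).mul (differentiable_monomialFun α)

/-- A finite sum, padded with zero coefficients, is a series to which the Parseval identity
`lintegral_enorm_sq` applies. -/
lemma hasSum_finset_normalizedMonomial (s : Finset (ℕ × ℕ)) (d : ℕ × ℕ → ℂ) (q : Fin 2 → ℂ) :
    HasSum (fun α => (if α ∈ s then d α else 0) * normalizedMonomial N α q)
      (∑ α ∈ s, d α * normalizedMonomial N α q) := by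
  convert hasSum_sum_of_ne_finset_zero (s := s) (L := .unconditional _)
    (f := fun α => (if α ∈ s then d α else 0) * normalizedMonomial N α q) ?_ using 1
  · exact Finset.sum_congr rfl fun α hα => by simp [hα]
  · intro α hα
    simp [hα]

lemma lintegral_enorm_sq_normalizedMonomial (h : IsReinhardtWithNorms G N) (α : ℕ × ℕ) :
    ∫⁻ q in G, ‖normalizedMonomial N α q‖ₑ ^ 2 = 1 := by
  rw [h.lintegral_enorm_sq (continuous_normalizedMonomial α).continuousOn
    (c := fun β => if β ∈ ({α} : Finset _) then 1 else 0)
    fun q _ => by simpa using hasSum_finset_normalizedMonomial (N := N) {α} (fun _ => 1) q]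
  rw [tsum_eq_single α]
  · simp
  · intro β hβ
    simp [hβ]

lemma memLp (h : IsReinhardtWithNorms G N) (α : ℕ × ℕ) :
    MemLp (normalizedMonomial N α) 2 (volume.restrict G) := by
  refine ⟨(continuous_normalizedMonomial α).aestronglyMeasurable, ?_⟩
  have h1 : eLpNorm (normalizedMonomial N α) 2 (volume.restrict G) ^ 2 < ⊤ := by
    rw [eLpNorm_two_sq, h.lintegral_enorm_sq_normalizedMonomial]
    exact ENNReal.one_lt_top
  simpa using h1

lemma inBergmanSpace (h : IsReinhardtWithNorms G N) (α : ℕ × ℕ) :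
    InBergmanSpace G (normalizedMonomial N α) :=
  ⟨(differentiable_normalizedMonomial α).differentiableOn, h.memLp α⟩

/-- The normalized monomials as elements of `L²(G)`. -/
noncomputable def toL2 (h : IsReinhardtWithNorms G N) (α : ℕ × ℕ) :
    Lp ℂ 2 (volume.restrict G) := (h.memLp α).toLp _

lemma norm_toL2 (h : IsReinhardtWithNorms G N) (α : ℕ × ℕ) : ‖h.toL2 α‖ = 1 := by
  have h1 : ‖h.toL2 α‖ₑ ^ 2 = 1 :=
    (enorm_toLp_sq (h.memLp α)).trans (h.lintegral_enorm_sq_normalizedMonomial α)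
  have h2 : ‖h.toL2 α‖ ^ 2 = 1 := by
    rw [← toReal_enorm, ← ENNReal.toReal_pow, h1, ENNReal.toReal_one]
  exact (pow_eq_one_iff_of_nonneg (norm_nonneg _) two_ne_zero).1 h2

/-- Orthogonality is read off from Parseval: the squared norm of `e_α + b e_β` is `1 + |b|²` for
every `b`. -/
lemma orthonormal_toL2 (h : IsReinhardtWithNorms G N) : Orthonormal ℂ h.toL2 := by
  refine ⟨h.norm_toL2, fun α β hαβ => inner_eq_zero_of_norm_add_smul_sq fun b => ?_⟩
  have hm : MemLp (fun q => normalizedMonomial N α q + b * normalizedMonomial N β q) 2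
      (volume.restrict G) := (h.memLp α).add ((h.memLp β).const_mul b)
  have h1 : h.toL2 α + b • h.toL2 β = hm.toLp _ := rfl
  have h2 : ‖hm.toLp _‖ₑ ^ 2 = 1 + ‖b‖ₑ ^ 2 := by
    have hcont : Continuous fun q => normalizedMonomial N α q + b * normalizedMonomial N β q :=
      (continuous_normalizedMonomial α).add
        (continuous_const.mul (continuous_normalizedMonomial β))
    rw [enorm_toLp_sq, h.lintegral_enorm_sq hcont.continuousOn
      (c := fun γ => if γ ∈ ({α, β} : Finset _) then (if γ = α then 1 else b) else 0)
      fun q _ => by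
        have := hasSum_finset_normalizedMonomial (N := N) {α, β}
          (fun γ => if γ = α then 1 else b) q
        rw [Finset.sum_pair hαβ] at this
        simpa [hαβ.symm] using this]
    rw [tsum_eq_sum (s := {α, β}) (fun γ hγ => by simp [hγ]), Finset.sum_pair hαβ]
    simp [hαβ.symm]
  rw [h1, h.norm_toL2, h.norm_toL2, ← toReal_enorm, ← ENNReal.toReal_pow, h2,
    ENNReal.toReal_add (by simp) (by finiteness)]
  simp

/-- Every element of `A²(G)` has an expansion in normalized monomials, which converges pointwise
and in `L²(G)`. -/
lemma exists_expansion (h : IsReinhardtWithNorms G N) {f : (Fin 2 → ℂ) → ℂ}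
    (hf : InBergmanSpace G f) :
    ∃ c : ℕ × ℕ → ℂ, (∀ q ∈ G, HasSum (fun α => c α * normalizedMonomial N α q) (f q)) ∧
      HasSum (fun α => c α • h.toL2 α) (hf.2.toLp f) := by
  obtain ⟨c₀, hc₀⟩ := exists_hasSum_monomialFun h.isOpen h.reinhardt hf.1
  set c : ℕ × ℕ → ℂ := fun α => c₀ α * (√(N α) : ℝ) with hcdef
  have hc : ∀ q ∈ G, HasSum (fun α => c α * normalizedMonomial N α q) (f q) := fun q hq => by
    have hα : ∀ α, c α * normalizedMonomial N α q = c₀ α * monomialFun α q := fun α => by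
      have : (√(N α) : ℂ) ≠ 0 := by
        exact_mod_cast (Real.sqrt_pos.2 (h.pos α)).ne'
      simp only [hcdef, normalizedMonomial]
      push_cast
      field_simp
    simpa only [hα] using hc₀ q hq
  refine ⟨c, hc, ?_⟩
  have hpar := h.lintegral_enorm_sq hf.1.continuousOn hc
  have hfin : ∑' α, ‖c α‖ₑ ^ 2 ≠ ⊤ := by
    rw [← hpar, ← enorm_toLp_sq hf.2]
    finiteness
  -- Parseval applied to the partial sum minus `f` turns the `L²` error into the tail of the
  -- convergent series `∑ |c α|²`.
  have hdist : ∀ s : Finset (ℕ × ℕ), ‖∑ α ∈ s, c α • h.toL2 α - hf.2.toLp f‖ₑ ^ 2 =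
      ∑' α : { x // x ∉ s }, ‖c α‖ₑ ^ 2 := by
    intro s
    have hm : MemLp (fun q => ∑ α ∈ s, c α * normalizedMonomial N α q) 2 (volume.restrict G) :=
      memLp_finsetSum s fun α _ => (h.memLp α).const_mul (c α)
    rw [show ∑ α ∈ s, c α • h.toL2 α = _ from sum_smul_toLp h.memLp c s hm, ← MemLp.toLp_sub,
      enorm_toLp_sq, h.lintegral_enorm_sq (c := fun α => (if α ∈ s then c α else 0) - c α)]
    · refine Eq.trans (tsum_congr fun α => ?_)
        (tsum_subtype {α | α ∉ s} fun α => ‖c α‖ₑ ^ 2).symm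
      by_cases hα : α ∈ s <;> simp [hα]
    · refine ContinuousOn.sub (Continuous.continuousOn ?_) hf.1.continuousOn
      exact continuous_finsetSum _ fun α _ =>
        continuous_const.mul (continuous_normalizedMonomial α)
    · intro q hq
      have := (hasSum_finset_normalizedMonomial (N := N) s c q).sub (hc q hq)
      simp only [← sub_mul] at this
      exact this
  rw [HasSum, SummationFilter.unconditional_filter, tendsto_iff_edist_tendsto_0,
    ENNReal.tendsto_nhds_zero]
  intro ε hε
  have h0 := ENNReal.tendsto_nhds_zero.1 (ENNReal.tendsto_tsum_compl_atTop_zero hfin) (ε ^ 2)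
    (ENNReal.pow_pos hε 2)
  filter_upwards [h0] with s hs
  rw [← hdist s] at hs
  rw [edist_eq_enorm_sub]
  exact (ENNReal.pow_le_pow_left_iff two_ne_zero).1 hs

theorem isBergmanBasis (h : IsReinhardtWithNorms G N) :
    IsBergmanBasis G fun j => normalizedMonomial N (Nat.pairEquiv.symm j) where
  mem j := h.inBergmanSpace _
  orthonormal i j := by
    rw [← inner_toLp_eq_integral (h.memLp _) (h.memLp _)]
    refine (orthonormal_iff_ite.1 h.orthonormal_toL2 _ _).trans ?_
    simp only [EmbeddingLike.apply_eq_iff_eq, eq_comm]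
  dense f hf ε hε := by
    obtain ⟨c, -, hc⟩ := h.exists_expansion hf
    have h1 := (Nat.pairEquiv.symm.hasSum_iff.2 hc).tendsto_sum_nat
    rw [tendsto_iff_edist_tendsto_0] at h1
    obtain ⟨n, hn⟩ := (h1.eventually_lt_const hε).exists
    refine ⟨n, fun j => c (Nat.pairEquiv.symm j), ?_⟩
    have hm : MemLp (fun q => ∑ j ∈ Finset.range n, c (Nat.pairEquiv.symm j) *
        normalizedMonomial N (Nat.pairEquiv.symm j) q) 2 (volume.restrict G) :=
      memLp_finsetSum _ fun j _ => (h.memLp _).const_mul _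
    refine lt_of_eq_of_lt ?_ hn
    have h2 := sum_smul_toLp (fun j => h.memLp (Nat.pairEquiv.symm j))
      (fun j => c (Nat.pairEquiv.symm j)) (Finset.range n) hm
    simp only [Function.comp_apply]
    rw [edist_comm, edist_eq_enorm_sub]
    refine Eq.trans ?_ (congrArg (fun x => ‖hf.2.toLp f - x‖ₑ) h2).symm
    rw [← MemLp.toLp_sub, Lp.enorm_toLp]
    rfl

/-- The Bergman kernel on the diagonal is the sum of the squares of any orthonormal basis. -/
theorem hasSum_norm_sq_basis (h : IsReinhardtWithNorms G N) {φ : ℕ → (Fin 2 → ℂ) → ℂ}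
    (hφ : IsBergmanBasis G φ) {q : Fin 2 → ℂ} (hq : q ∈ G) {K : ℝ}
    (hK : HasSum (fun α => ‖normalizedMonomial N α q‖ ^ 2) K) :
    HasSum (fun j => ‖φ j q‖ ^ 2) K := by
  set Φ : ℕ → Lp ℂ 2 (volume.restrict G) := fun j => (hφ.mem j).2.toLp _ with hΦ
  have hΦo : Orthonormal ℂ Φ := orthonormal_iff_ite.2 fun i j => by
    rw [hΦ, inner_toLp_eq_integral, hφ.orthonormal]
    simp only [eq_comm]
  have hdense : ∀ f (hf : InBergmanSpace G f),
      hf.2.toLp f ∈ (Submodule.span ℂ (range Φ)).topologicalClosure := by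
    intro f hf
    rw [← SetLike.mem_coe, Submodule.topologicalClosure_coe, EMetric.mem_closure_iff]
    intro ε hε
    obtain ⟨n, c, hc⟩ := hφ.dense f hf ε hε
    refine ⟨∑ j ∈ Finset.range n, c j • Φ j, Submodule.sum_mem _ fun j _ =>
      Submodule.smul_mem _ _ (Submodule.subset_span ⟨j, rfl⟩), ?_⟩
    have hm : MemLp (fun q => ∑ j ∈ Finset.range n, c j * φ j q) 2 (volume.restrict G) :=
      memLp_finsetSum _ fun j _ => (hφ.mem j).2.const_mul _
    rw [sum_smul_toLp (fun j => (hφ.mem j).2) c (Finset.range n) hm, edist_eq_enorm_sub,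
      ← MemLp.toLp_sub, Lp.enorm_toLp]
    exact hc
  -- `k` is the reproducing vector at `q`: its monomial coefficients are the conjugates of the
  -- values at `q`, so `‖k‖² = K` and `⟨k, f⟩ = f q` on the Bergman space.
  obtain ⟨k, hk⟩ := h.orthonormal_toL2.summable_smul
    (d := fun α => starRingEnd ℂ (normalizedMonomial N α q)) (by simpa using hK.summable)
  have hkK : ‖k‖ ^ 2 = K :=
    (h.orthonormal_toL2.hasSum_norm_sq hk).unique (by simpa using hK)
  have hrep : ∀ f (hf : InBergmanSpace G f), inner ℂ k (hf.2.toLp f) = f q := by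
    intro f hf
    obtain ⟨c, hcq, hcL⟩ := h.exists_expansion hf
    have h1 := (innerSL ℂ k).hasSum hcL
    have hterm : ∀ α, innerSL ℂ k (c α • h.toL2 α) = c α * normalizedMonomial N α q := fun α => by
      rw [map_smul, innerSL_apply_apply, ← inner_conj_symm,
        h.orthonormal_toL2.inner_eq_of_hasSum hk α, Complex.conj_conj, smul_eq_mul]
    simp only [hterm] at h1
    exact h1.unique (hcq q hq)
  -- As a limit of combinations of monomials, `k` lies in the closed span of the given basis. Its
  -- coefficients there have modulus `‖φ j q‖`, so Parseval for that basis yields the sum `‖k‖² =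
  -- K`.
  have hkc : k ∈ (Submodule.span ℂ (range Φ)).topologicalClosure := by
    refine (Submodule.isClosed_topologicalClosure _).mem_of_tendsto hk
      (Filter.Eventually.of_forall fun s => Submodule.sum_mem _ fun α _ =>
        Submodule.smul_mem _ _ (hdense _ (h.inBergmanSpace α)))
  obtain ⟨d, hd⟩ := hΦo.exists_hasSum_of_mem_closure hkc
  have h3 := hΦo.hasSum_norm_sq hd
  rw [hkK] at h3
  convert h3 using 2 with j
  rw [← hΦo.inner_eq_of_hasSum hd j, ← hrep _ (hφ.mem j), ← inner_conj_symm, RCLike.norm_conj]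

theorem bergmanKernel_eq (h : IsReinhardtWithNorms G N) {q : Fin 2 → ℂ} (hq : q ∈ G) {K : ℝ}
    (hK : HasSum (fun α => ‖normalizedMonomial N α q‖ ^ 2) K) : bergmanKernel G q = K := by
  have hex : ∃ φ, IsBergmanBasis G φ := ⟨_, h.isBergmanBasis⟩
  rw [bergmanKernel, dif_pos hex]
  exact (h.hasSum_norm_sq_basis hex.choose_spec hq hK).tsum_eq

end IsReinhardtWithNorms

end Kernel

/-! ### The norms of the monomials on the ellipsoid. -/

section Ellipsoid

open Set
open scoped ENNReal

/-- The image of Lebesgue measure under `z ↦ |z|²`. -/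
lemma map_normSq_volume : (volume : Measure ℂ).map (fun z => ‖z‖ ^ 2) =
    ENNReal.ofReal Real.pi • volume.restrict (Ioi (0 : ℝ)) := by
  have hm : Measurable fun z : ℂ => ‖z‖ ^ 2 := by fun_prop
  symm
  have : IsLocallyFiniteMeasure (ENNReal.ofReal Real.pi • volume.restrict (Ioi (0 : ℝ))) :=
    inferInstanceAs (IsLocallyFiniteMeasure (Real.toNNReal Real.pi • volume.restrict (Ioi (0 : ℝ))))
  refine Measure.ext_of_Ioc _ _ fun a b hab => ?_
  -- The sublevel sets are discs of area `π x`; for `x < 0` they are empty and `ENNReal.ofReal x` is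
  -- `0`, so one formula covers both cases.
  have hball : ∀ x : ℝ, volume {z : ℂ | ‖z‖ ^ 2 ≤ x} = ENNReal.ofReal Real.pi * ENNReal.ofReal x := by
    intro x
    rcases lt_or_ge x 0 with hx | hx
    · have : {z : ℂ | ‖z‖ ^ 2 ≤ x} = ∅ := by
        ext z
        simpa using hx.trans_le (by positivity)
      rw [this, measure_empty, ENNReal.ofReal_of_nonpos hx.le, mul_zero]
    · have : {z : ℂ | ‖z‖ ^ 2 ≤ x} = Metric.closedBall 0 (√x) := by
        ext z
        simp [Real.le_sqrt (norm_nonneg z) hx]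
      rw [this, Complex.volume_closedBall, ← ENNReal.ofReal_pow (Real.sqrt_nonneg _),
        Real.sq_sqrt hx, mul_comm]
      congr 1
      rw [ENNReal.ofReal, Real.toNNReal_of_nonneg Real.pi_pos.le]
      rfl
  have hset : (fun z : ℂ => ‖z‖ ^ 2) ⁻¹' Ioc a b = {z : ℂ | ‖z‖ ^ 2 ≤ b} \ {z : ℂ | ‖z‖ ^ 2 ≤ a} := by
    ext z
    simp [and_comm]
  have hsub : {z : ℂ | ‖z‖ ^ 2 ≤ a} ⊆ {z : ℂ | ‖z‖ ^ 2 ≤ b} := fun z hz => le_trans hz hab.le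
  rw [Measure.map_apply hm measurableSet_Ioc, hset, measure_sdiff hsub
    (hm measurableSet_Iic).nullMeasurableSet (by rw [hball]; finiteness), hball, hball,
    Measure.smul_apply, Measure.restrict_apply measurableSet_Ioc, smul_eq_mul,
    Ioc_inter_Ioi, Real.volume_Ioc, ← ENNReal.mul_sub (by simp)]
  congr 1
  rcases le_total a 0 with ha | ha
  · rw [sup_eq_right.2 ha, ENNReal.ofReal_of_nonpos ha, sub_zero, tsub_zero]
  · rw [sup_eq_left.2 ha, ENNReal.ofReal_sub _ ha]

lemma lintegral_comp_norm_sq {H : ℝ → ℝ≥0∞} (hH : Measurable H) :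
    ∫⁻ z : ℂ, H (‖z‖ ^ 2) = ENNReal.ofReal Real.pi * ∫⁻ s in Ioi (0 : ℝ), H s := by
  rw [← lintegral_map hH (by fun_prop), map_normSq_volume, lintegral_smul_measure, smul_eq_mul]

lemma lintegral_comp_norm_sq_two {H : ℝ × ℝ → ℝ≥0∞} (hH : Measurable H) :
    ∫⁻ q : Fin 2 → ℂ, H (‖q 0‖ ^ 2, ‖q 1‖ ^ 2) = ENNReal.ofReal Real.pi ^ 2 *
      ∫⁻ s in Ioi (0 : ℝ), ∫⁻ t in Ioi (0 : ℝ), H (s, t) := by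
  have hm : Measurable fun x : ℂ × ℂ => H (‖x.1‖ ^ 2, ‖x.2‖ ^ 2) := hH.comp (by fun_prop)
  have h1 := (volume_preserving_finTwoArrow ℂ).lintegral_comp hm
  have h2 : Measurable fun s => ∫⁻ t in Ioi (0 : ℝ), H (s, t) := hH.lintegral_prod_right'
  calc _ = ∫⁻ x : ℂ × ℂ, H (‖x.1‖ ^ 2, ‖x.2‖ ^ 2) := h1
    _ = ∫⁻ z : ℂ, ∫⁻ w : ℂ, H (‖z‖ ^ 2, ‖w‖ ^ 2) := by
      rw [Measure.volume_eq_prod, lintegral_prod _ hm.aemeasurable]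
    _ = ∫⁻ z : ℂ, ENNReal.ofReal Real.pi * ∫⁻ t in Ioi (0 : ℝ), H (‖z‖ ^ 2, t) :=
      lintegral_congr fun z => lintegral_comp_norm_sq (H := fun t => H (‖z‖ ^ 2, t)) (by fun_prop)
    _ = _ := by
      rw [lintegral_comp_norm_sq (H := fun s => ENNReal.ofReal Real.pi *
        ∫⁻ t in Ioi (0 : ℝ), H (s, t)) (h2.const_mul _), lintegral_const_mul _ h2, sq, mul_assoc]

lemma lintegral_Ioo_pow {T : ℝ} (hT : 0 ≤ T) (b : ℕ) :
    ∫⁻ t in Ioo 0 T, ENNReal.ofReal (t ^ b) = ENNReal.ofReal (T ^ (b + 1) / (b + 1)) := by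
  have hint : IntegrableOn (fun t : ℝ => t ^ b) (Ioo 0 T) :=
    ((continuous_pow b).integrableOn_Icc (a := 0) (b := T)).mono_set Ioo_subset_Icc_self
  rw [← ofReal_integral_eq_lintegral_ofReal hint, ← integral_Ioc_eq_integral_Ioo,
    ← intervalIntegral.integral_of_le hT, integral_pow]
  · simp
  · filter_upwards [ae_restrict_mem measurableSet_Ioo] with t ht using pow_nonneg ht.1.le b

lemma lintegral_Ioo_beta (a : ℕ) {c : ℝ} (hc : 0 < c) :
    ∫⁻ s in Ioo (0 : ℝ) 1, ENNReal.ofReal (s ^ a * (1 - s) ^ (c - 1)) =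
      ENNReal.ofReal (a.factorial / ∏ j ∈ Finset.range (a + 1), (c + j)) := by
  have hcc : 0 < (c : ℂ).re := by simpa
  have ha : 0 < ((a : ℂ) + 1).re := by simp; positivity
  have hfun : EqOn (fun s : ℝ => (s : ℂ) ^ ((a : ℂ) + 1 - 1) * (1 - (s : ℂ)) ^ ((c : ℂ) - 1))
      (fun s : ℝ => ((s ^ a * (1 - s) ^ (c - 1) : ℝ) : ℂ)) (Ioo 0 1) := by
    intro s hs
    have : (1 - (s : ℂ)) ^ ((c : ℂ) - 1) = (((1 - s) ^ (c - 1) : ℝ) : ℂ) := by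
      rw [Complex.ofReal_cpow (by linarith [hs.2])]
      push_cast
      rfl
    simp only [add_sub_cancel_right, Complex.cpow_natCast, this]
    push_cast
    rfl
  have hconv := Complex.betaIntegral_convergent ha hcc
  rw [intervalIntegrable_iff_integrableOn_Ioo_of_le zero_le_one] at hconv
  have hint : IntegrableOn (fun s : ℝ => s ^ a * (1 - s) ^ (c - 1)) (Ioo 0 1) := by
    have := (hconv.congr_fun hfun measurableSet_Ioo).re
    simpa only [RCLike.re_eq_complex_re, Complex.ofReal_re, IntegrableOn] using this
  have hbeta := Complex.betaIntegral_eval_nat_add_one_right hcc a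
  rw [Complex.betaIntegral_symm, Complex.betaIntegral, intervalIntegral.integral_of_le zero_le_one,
    integral_Ioc_eq_integral_Ioo, setIntegral_congr_fun measurableSet_Ioo hfun,
    integral_complex_ofReal] at hbeta
  rw [← ofReal_integral_eq_lintegral_ofReal hint]
  · congr 1
    exact_mod_cast hbeta
  · filter_upwards [ae_restrict_mem measurableSet_Ioo] with s hs
    exact mul_nonneg (pow_nonneg hs.1.le a) (Real.rpow_nonneg (by linarith [hs.2]) _)

variable {p : ℝ}

/-- The squared norm of `z^a w^b` in `L²(E(1,1,p))`. -/
noncomputable def ellipsoidNorm (p : ℝ) (α : ℕ × ℕ) : ℝ :=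
  Real.pi ^ 2 * (α.1.factorial / ∏ j ∈ Finset.range (α.1 + 1), ((α.2 + 1) / p + 1 + j)) / (α.2 + 1)

lemma ellipsoidNorm_pos (hp : 0 < p) (α : ℕ × ℕ) : 0 < ellipsoidNorm p α := by
  have : 0 < ∏ j ∈ Finset.range (α.1 + 1), (((α.2 : ℝ) + 1) / p + 1 + j) :=
    Finset.prod_pos fun j _ => by positivity
  unfold ellipsoidNorm
  positivity

lemma mem_ellipsoid_iff {q : Fin 2 → ℂ} :
    q ∈ ellipsoid p ↔ ‖q 0‖ ^ 2 + (‖q 1‖ ^ 2) ^ p < 1 := by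
  rw [ellipsoid, mem_ofPred_eq, Real.rpow_mul (norm_nonneg _), Real.rpow_two]

lemma isOpen_ellipsoid (hp : 0 < p) : IsOpen (ellipsoid p) := by
  have h : Continuous fun q : Fin 2 → ℂ => ‖q 0‖ ^ 2 + ‖q 1‖ ^ (2 * p) :=
    ((continuous_apply 0).norm.pow 2).add
      ((continuous_apply 1).norm.rpow_const fun _ => Or.inr (by positivity))
  exact isOpen_lt h continuous_const

lemma isCompleteReinhardt_ellipsoid (hp : 0 < p) : IsCompleteReinhardt (ellipsoid p) := by
  intro q hq q' h
  have h0 : ‖q' 0‖ ^ 2 ≤ ‖q 0‖ ^ 2 := pow_le_pow_left₀ (norm_nonneg _) (h 0) 2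
  have h1 : ‖q' 1‖ ^ (2 * p) ≤ ‖q 1‖ ^ (2 * p) :=
    Real.rpow_le_rpow (norm_nonneg _) (h 1) (by positivity)
  exact (add_le_add h0 h1).trans_lt hq

lemma lintegral_monomialFun_ellipsoid (hp : 0 < p) (α : ℕ × ℕ) :
    ∫⁻ q in ellipsoid p, ‖monomialFun α q‖ₑ ^ 2 = ENNReal.ofReal (ellipsoidNorm p α) := by
  obtain ⟨a, b⟩ := α
  set D : Set (ℝ × ℝ) := {x | x.1 + x.2 ^ p < 1} with hD
  have hDm : MeasurableSet D := measurableSet_lt (by fun_prop) measurable_const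
  set H : ℝ × ℝ → ℝ≥0∞ := D.indicator fun x => ENNReal.ofReal (x.1 ^ a) * ENNReal.ofReal (x.2 ^ b)
    with hHdef
  have hH : Measurable H := Measurable.indicator (by fun_prop) hDm
  have h1 : ∀ q : Fin 2 → ℂ, (ellipsoid p).indicator (fun q => ‖monomialFun (a, b) q‖ₑ ^ 2) q =
      H (‖q 0‖ ^ 2, ‖q 1‖ ^ 2) := by
    intro q
    by_cases hq : q ∈ ellipsoid p
    · have hq' : (‖q 0‖ ^ 2, ‖q 1‖ ^ 2) ∈ D := mem_ellipsoid_iff.1 hq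
      rw [indicator_of_mem hq, hHdef, indicator_of_mem hq', monomialFun, ← ofReal_norm,
        ← ENNReal.ofReal_pow (norm_nonneg _), ← ENNReal.ofReal_mul (by positivity), norm_mul,
        norm_pow, norm_pow]
      congr 1
      ring
    · have hq' : (‖q 0‖ ^ 2, ‖q 1‖ ^ 2) ∉ D := fun h => hq (mem_ellipsoid_iff.2 h)
      rw [indicator_of_notMem hq, hHdef, indicator_of_notMem hq']
  set c : ℝ := ((b : ℝ) + 1) / p + 1 with hc
  -- For `s < 1` the fibre is `0 < t < (1 - s)^(1/p)`, and integrating `t^b` gives `(1 - s)^((b +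
  -- 1)/p) / (b + 1)`, whose exponent is `c - 1`. For `s ≥ 1` the fibre is empty.
  have h2 : ∀ s ∈ Ioi (0 : ℝ), ∫⁻ t in Ioi (0 : ℝ), H (s, t) = (Ioo (0 : ℝ) 1).indicator
      (fun s => ENNReal.ofReal (1 / (b + 1)) * ENNReal.ofReal (s ^ a * (1 - s) ^ (c - 1))) s := by
    intro s (hs : 0 < s)
    rcases lt_or_ge s 1 with hs1 | hs1
    · have h1s : 0 ≤ 1 - s := by linarith
      have hind : ∀ t ∈ Ioi (0 : ℝ), H (s, t) = (Ioo 0 ((1 - s) ^ p⁻¹)).indicator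
          (fun t => ENNReal.ofReal (s ^ a) * ENNReal.ofReal (t ^ b)) t := by
        intro t (ht : 0 < t)
        have hiff : (s, t) ∈ D ↔ t ∈ Ioo 0 ((1 - s) ^ p⁻¹) := by
          simp only [hD, mem_ofPred_eq, mem_Ioo, ht, true_and]
          rw [Real.lt_rpow_inv_iff_of_pos ht.le h1s hp]
          constructor <;> intro <;> linarith
        by_cases h : (s, t) ∈ D
        · rw [hHdef, indicator_of_mem h, indicator_of_mem (hiff.1 h)]
        · rw [hHdef, indicator_of_notMem h, indicator_of_notMem fun h' => h (hiff.2 h')]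
      rw [setLIntegral_congr_fun measurableSet_Ioi hind, lintegral_indicator measurableSet_Ioo,
        Measure.restrict_restrict measurableSet_Ioo, inter_eq_left.2 fun t ht => ht.1,
        lintegral_const_mul _ (by fun_prop), lintegral_Ioo_pow (Real.rpow_nonneg h1s _),
        indicator_of_mem (show s ∈ Ioo (0 : ℝ) 1 from ⟨hs, hs1⟩),
        ← ENNReal.ofReal_mul (by positivity), ← ENNReal.ofReal_mul (by positivity)]
      have hpow : ((1 - s) ^ p⁻¹) ^ (b + 1) = (1 - s) ^ (c - 1) := by
        rw [← Real.rpow_mul_natCast h1s]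
        congr 1
        rw [hc]
        push_cast
        ring
      rw [hpow]
      congr 1
      ring
    · rw [indicator_of_notMem fun h => absurd h.2 hs1.not_gt,
        setLIntegral_congr_fun (g := fun _ => 0) measurableSet_Ioi, lintegral_zero]
      intro t (ht : 0 < t)
      refine indicator_of_notMem (fun h => ?_) _
      have h' : s + t ^ p < 1 := h
      have := Real.rpow_nonneg ht.le p
      linarith
  rw [← lintegral_indicator (isOpen_ellipsoid hp).measurableSet]
  simp only [h1]
  rw [lintegral_comp_norm_sq_two hH, setLIntegral_congr_fun measurableSet_Ioi h2,
    lintegral_indicator measurableSet_Ioo, Measure.restrict_restrict measurableSet_Ioo,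
    inter_eq_left.2 fun t ht => ht.1, lintegral_const_mul _ (by fun_prop),
    lintegral_Ioo_beta a (by positivity), ← ENNReal.ofReal_pow Real.pi_pos.le,
    ← ENNReal.ofReal_mul (by positivity), ← ENNReal.ofReal_mul (by positivity), ellipsoidNorm]
  congr 1
  simp only [hc]
  ring

theorem isReinhardtWithNorms_ellipsoid (hp : 0 < p) :
    IsReinhardtWithNorms (ellipsoid p) (ellipsoidNorm p) :=
  ⟨isOpen_ellipsoid hp, isCompleteReinhardt_ellipsoid hp, ellipsoidNorm_pos hp,
    lintegral_monomialFun_ellipsoid hp⟩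

end Ellipsoid

/-! ### Summation of the kernel in closed form. -/

section KernelSum

open Set

lemma HasSum.congr_of_eq {ι : Type*} {f g : ι → ℝ} {a b : ℝ} (h : HasSum f a)
    (hfg : ∀ i, g i = f i) (hab : b = a) : HasSum g b := by
  rwa [hab, funext hfg]

/-- The product of the `c + j` over `j ≤ n` is `c` times the rising factorial of `c + 1`, so this is
`c` times the binomial series with exponent `-(c + 1)`. -/
lemma hasSum_binomial {c s : ℝ} (hs : |s| < 1) :
    HasSum (fun n : ℕ => (∏ j ∈ Finset.range (n + 1), (c + j)) / n.factorial * s ^ n)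
      (c * (1 - s) ^ (-(c + 1))) := by
  have h := (Real.one_div_one_sub_rpow_hasFPowerSeriesOnBall_zero (c + 1)).hasSum (y := s)
    (by simpa [enorm_eq_nnnorm, ← NNReal.coe_lt_coe] using hs)
  have hcoef : ∀ n : ℕ, (∏ j ∈ Finset.range (n + 1), (c + j)) / n.factorial =
      c * Ring.choose (c + 1 + n - 1) n := by
    intro n
    have h1 := Ring.factorial_nsmul_multichoose_eq_ascPochhammer (c + 1) n
    rw [Polynomial.ascPochhammer_smeval_eq_eval, nsmul_eq_mul, Ring.multichoose_eq] at h1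
    have h2 : ∀ n : ℕ, (ascPochhammer ℝ n).eval (c + 1) = ∏ j ∈ Finset.range n, (c + 1 + j) := by
      intro n
      induction n with
      | zero => simp
      | succ n ih => rw [ascPochhammer_succ_eval, ih, Finset.prod_range_succ]
    rw [h2] at h1
    have h3 : (n.factorial : ℝ) ≠ 0 := by positivity
    rw [div_eq_iff h3, Finset.prod_range_succ', mul_assoc c, mul_comm _ (n.factorial : ℝ), h1]
    push_cast
    rw [add_zero, mul_comm]
    congr 1
    exact Finset.prod_congr rfl fun j _ => by ring
  have hs1 : 0 < 1 - s := by linarith [(abs_lt.1 hs).2]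
  have h' := h.mul_left c
  simp only [zero_add, FormalMultilinearSeries.ofScalars_apply_eq, smul_eq_mul] at h'
  rw [Real.rpow_neg hs1.le, ← one_div]
  simpa only [hcoef, mul_assoc] using h'

lemma hasSum_quadratic_mul_geometric {p x : ℝ} (hp : 0 < p) (hx : |x| < 1) :
    HasSum (fun b : ℕ => ((b : ℝ) + 1) * (((b : ℝ) + 1) / p + 1) * x ^ b)
      (((p + 1) - (p - 1) * x) / (p * (1 - x) ^ 3)) := by
  have h1 := hasSum_choose_mul_geometric_of_norm_lt_one 1 (r := x) (by simpa using hx)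
  have h2 := hasSum_choose_mul_geometric_of_norm_lt_one 2 (r := x) (by simpa using hx)
  -- The decomposition used is `(b+1)((b+1)/p + 1) = (2/p) C(b+2, 2) + ((p-1)/p) C(b+1, 1)`.
  have h3 := (h2.mul_left (2 / p)).add (h1.mul_left ((p - 1) / p))
  have hx1 : 1 - x ≠ 0 := by linarith [(abs_lt.1 hx).2]
  refine h3.congr_of_eq (fun b => ?_) ?_
  · have : (((b + 2).choose 2 : ℕ) : ℝ) = (b + 2) * (b + 1) / 2 := by
      rw [Nat.cast_choose_two]
      push_cast
      ring
    rw [this, Nat.choose_one_right]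
    push_cast
    field_simp
    ring
  · field_simp
    ring

lemma hasSum_prod_of_nonneg {f : ℕ × ℕ → ℝ} (hf : ∀ x, 0 ≤ f x) {g : ℕ → ℝ} {S : ℝ}
    (h1 : ∀ b, HasSum (fun a => f (a, b)) (g b)) (h2 : HasSum g S) : HasSum f S := by
  have hs : Summable (f ∘ Equiv.prodComm ℕ ℕ) := by
    refine (summable_prod_of_nonneg fun x => hf _).2 ⟨fun b => (h1 b).summable, ?_⟩
    simpa only [Function.comp, Equiv.prodComm_apply, Prod.swap_prod_mk, (h1 _).tsum_eq]
      using h2.summable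
  have h3 := hs.hasSum.prod_fiberwise h1
  rw [← (Equiv.prodComm ℕ ℕ).hasSum_iff, ← h3.unique h2]
  exact hs.hasSum

/-- The Bergman kernel of the ellipsoid in terms of `s = |z|²` and `x = |w|² (1 - |z|²)^(-1/p)`. -/
noncomputable def ellipsoidKernel (p s x : ℝ) : ℝ :=
  (1 - s) ^ (-(1 / p + 2)) * (((p + 1) - (p - 1) * x) / (p * (1 - x) ^ 3)) / Real.pi ^ 2

theorem bergmanKernel_ellipsoid {p : ℝ} (hp : 0 < p) {q : Fin 2 → ℂ} (hq : q ∈ ellipsoid p) :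
    bergmanKernel (ellipsoid p) q =
      ellipsoidKernel p (‖q 0‖ ^ 2) (‖q 1‖ ^ 2 * (1 - ‖q 0‖ ^ 2) ^ (-(1 / p))) := by
  refine (isReinhardtWithNorms_ellipsoid hp).bergmanKernel_eq hq ?_
  simp only [norm_normalizedMonomial_sq (ellipsoidNorm_pos hp)]
  rw [mem_ellipsoid_iff] at hq
  set s := ‖q 0‖ ^ 2 with hs
  set t := ‖q 1‖ ^ 2 with ht
  have hs0 : 0 ≤ s := by positivity
  have ht0 : 0 ≤ t := by positivity
  have hs1 : 0 < 1 - s := by linarith [Real.rpow_nonneg ht0 p]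
  set x := t * (1 - s) ^ (-(1 / p)) with hx
  have hu : 0 < (1 - s) ^ (-(1 / p)) := Real.rpow_pos_of_pos hs1 _
  have hx0 : 0 ≤ x := by positivity
  have hx1 : x < 1 := by
    have h1 : t < (1 - s) ^ p⁻¹ := by
      rw [Real.lt_rpow_inv_iff_of_pos ht0 hs1.le hp]
      linarith
    rw [hx, Real.rpow_neg hs1.le, one_div, mul_inv_lt_iff₀ (Real.rpow_pos_of_pos hs1 _), one_mul]
    exact h1
  refine hasSum_prod_of_nonneg (g := fun b => (1 - s) ^ (-(1 / p + 2)) / Real.pi ^ 2 *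
    (((b : ℝ) + 1) * (((b : ℝ) + 1) / p + 1) * x ^ b)) ?_ ?_ ?_
  · intro α
    have := ellipsoidNorm_pos hp α
    positivity
  · intro b
    have h1 := (hasSum_binomial (c := ((b : ℝ) + 1) / p + 1)
      (s := s)
      (abs_lt.2 ⟨by linarith, by linarith⟩)).mul_left (((b : ℝ) + 1) / Real.pi ^ 2 * t ^ b)
    refine h1.congr_of_eq (fun a => ?_) ?_
    · have : (∏ j ∈ Finset.range (a + 1), (((b : ℝ) + 1) / p + 1 + j)) ≠ 0 :=
        (Finset.prod_pos fun j _ => by positivity).ne'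
      have h3 : (a.factorial : ℝ) ≠ 0 := by positivity
      simp only [ellipsoidNorm]
      field_simp
    -- The exponent is affine in `b`; its `b`-dependent part is absorbed into `t^b`, which becomes
    -- `x^b`.
    · have h2 : (1 - s) ^ (-(((b : ℝ) + 1) / p + 1 + 1)) =
          (1 - s) ^ (-(1 / p + 2)) * ((1 - s) ^ (-(1 / p))) ^ b := by
        rw [← Real.rpow_mul_natCast hs1.le, ← Real.rpow_add hs1]
        congr 1
        field_simp
        ring
      rw [h2, hx, mul_pow]
      ring
  · have h1 := (hasSum_quadratic_mul_geometric hp (abs_lt.2 ⟨by linarith, hx1⟩)).mul_left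
      ((1 - s) ^ (-(1 / p + 2)) / Real.pi ^ 2)
    refine h1.congr_of_eq (fun _ => rfl) ?_
    rw [ellipsoidKernel]
    ring

end KernelSum

/-! ### The potential `log K`, its derivatives on the axis `w = 0`, and the curvatures. -/

section Curvature

open Set
open scoped ContDiff

variable {p : ℝ}

lemma normSq_lt_one_of_mem_ellipsoid {q : Fin 2 → ℂ} (hq : q ∈ ellipsoid p) :
    Complex.normSq (q 0) < 1 := by
  rw [mem_ellipsoid_iff] at hq
  rw [Complex.normSq_eq_norm_sq]
  have : 0 ≤ (‖q 1‖ ^ 2) ^ p := by positivity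
  linarith

/-- The variable `x = |w|² (1 - |z|²)^(-1/p)` is less than `1` on the ellipsoid. -/
lemma normSq_mul_rpow_lt_one (hp : 0 < p) {q : Fin 2 → ℂ} (hq : q ∈ ellipsoid p) :
    (1 - Complex.normSq (q 0)) ^ (-(1 / p)) * Complex.normSq (q 1) < 1 := by
  have hs := normSq_lt_one_of_mem_ellipsoid hq
  have hs1 : 0 < 1 - Complex.normSq (q 0) := by linarith
  rw [mem_ellipsoid_iff, ← Complex.normSq_eq_norm_sq, ← Complex.normSq_eq_norm_sq] at hq
  have h1 : Complex.normSq (q 1) < (1 - Complex.normSq (q 0)) ^ p⁻¹ := by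
    rw [Real.lt_rpow_inv_iff_of_pos (Complex.normSq_nonneg _) hs1.le hp]
    linarith
  rw [Real.rpow_neg hs1.le, one_div, inv_mul_lt_iff₀ (Real.rpow_pos_of_pos hs1 _), mul_one]
  exact h1

/-- The expression equals `p (1 - x) + (1 + x)`. -/
lemma affine_pos (hp : 0 < p) {x : ℝ} (hx0 : 0 ≤ x) (hx : x < 1) : 0 < p + 1 - (p - 1) * x := by
  nlinarith [mul_pos hp (sub_pos.2 hx)]

lemma log_bergmanKernel_ellipsoid (hp : 0 < p) {q : Fin 2 → ℂ} (hq : q ∈ ellipsoid p) {x : ℝ}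
    (hx : x = (1 - Complex.normSq (q 0)) ^ (-(1 / p)) * Complex.normSq (q 1)) :
    Real.log (bergmanKernel (ellipsoid p) q) =
      -(1 / p + 2) * Real.log (1 - Complex.normSq (q 0)) +
        (Real.log (p + 1 - (p - 1) * x) - 3 * Real.log (1 - x)) -
        Real.log (p * Real.pi ^ 2) := by
  have hs1 : 0 < 1 - Complex.normSq (q 0) := by linarith [normSq_lt_one_of_mem_ellipsoid hq]
  have hx0 : 0 ≤ x := hx ▸ mul_nonneg (Real.rpow_nonneg hs1.le _) (Complex.normSq_nonneg _)
  have hx1 : x < 1 := hx ▸ normSq_mul_rpow_lt_one hp hq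
  have h1 := affine_pos hp hx0 hx1
  have h2 : 0 < 1 - x := by linarith
  have h3 := Real.rpow_pos_of_pos hs1 (-(1 / p + 2))
  have hpi := Real.pi_pos
  rw [bergmanKernel_ellipsoid hp hq, ← Complex.normSq_eq_norm_sq, ← Complex.normSq_eq_norm_sq,
    mul_comm (Complex.normSq (q 1)), ← hx, ellipsoidKernel, mul_div_assoc, div_div,
    Real.log_mul h3.ne' (by positivity), Real.log_rpow hs1, Real.log_div h1.ne' (by positivity),
    mul_right_comm, Real.log_mul (by positivity) (by positivity), Real.log_pow]
  push_cast
  ring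

/-- The potential `log K` of the Bergman metric of the ellipsoid. -/
noncomputable def ellipsoidPotential (p : ℝ) (q : Fin 2 → ℂ) : ℂ :=
  (Real.log (bergmanKernel (ellipsoid p) q) : ℂ)

lemma contDiffOn_ellipsoidPotential (hp : 0 < p) :
    ContDiffOn ℝ ∞ (ellipsoidPotential p) (ellipsoid p) := by
  have hn : ∀ i, ContDiff ℝ ∞ fun q : Fin 2 → ℂ => Complex.normSq (q i) := fun i => by
    have hre : ContDiff ℝ ∞ fun q : Fin 2 → ℂ => (q i).re :=
      Complex.reCLM.contDiff.comp (contDiff_apply ℝ ℂ i)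
    have him : ContDiff ℝ ∞ fun q : Fin 2 → ℂ => (q i).im :=
      Complex.imCLM.contDiff.comp (contDiff_apply ℝ ℂ i)
    exact (hre.mul hre).add (him.mul him)
  have hs : ContDiffOn ℝ ∞ (fun q : Fin 2 → ℂ => 1 - Complex.normSq (q 0)) (ellipsoid p) :=
    (contDiff_const.sub (hn 0)).contDiffOn
  have hs1 : ∀ q ∈ ellipsoid p, 1 - Complex.normSq (q 0) ≠ 0 := fun q hq => by
    linarith [normSq_lt_one_of_mem_ellipsoid hq]
  have hx : ContDiffOn ℝ ∞ (fun q : Fin 2 → ℂ =>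
      (1 - Complex.normSq (q 0)) ^ (-(1 / p)) * Complex.normSq (q 1)) (ellipsoid p) :=
    (hs.rpow_const_of_ne hs1).mul (hn 1).contDiffOn
  have h1 := (hs.log hs1).const_smul (-(1 / p + 2))
  have h2 := (contDiffOn_const (c := p + 1)).sub ((contDiffOn_const (c := p - 1)).mul hx)
  have h3 := (contDiffOn_const (c := (1 : ℝ))).sub hx
  have hx0 : ∀ q ∈ ellipsoid p,
      0 ≤ (1 - Complex.normSq (q 0)) ^ (-(1 / p)) * Complex.normSq (q 1) := fun q hq =>
    mul_nonneg (Real.rpow_nonneg (by linarith [normSq_lt_one_of_mem_ellipsoid hq]) _)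
      (Complex.normSq_nonneg _)
  have h4 := (h1.add ((h2.log fun q hq =>
    (affine_pos hp (hx0 q hq) (normSq_mul_rpow_lt_one hp hq)).ne').sub
      ((h3.log fun q hq => (sub_pos.2 (normSq_mul_rpow_lt_one hp hq)).ne').const_smul (3 : ℝ)))).sub
      (contDiffOn_const (c := Real.log (p * Real.pi ^ 2)))
  refine (Complex.ofRealCLM.contDiff.comp_contDiffOn h4).congr fun q hq => ?_
  rw [ellipsoidPotential, log_bergmanKernel_ellipsoid hp hq rfl]
  rfl

/-! ### The potential on the slices `w = 0` and `z = const`. -/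

section AxisSlices

variable {q : Fin 2 → ℂ}

/-- On the disc `w = 0` the metric coefficient `g_{z z̄}` is `(1/p + 2) / (1 - |z|²)²`. -/
lemma dz_dzbar_potential_zero (hp : 0 < p) (hw : q 1 = 0) {ζ : ℂ}
    (hζ : ζ ∈ coordSlice (ellipsoid p) q 0) :
    dz 0 (dzbar 0 (ellipsoidPotential p)) (Function.update q 0 ζ) =
      (((1 / p + 2) / (1 - Complex.normSq ζ) ^ 2 : ℝ) : ℂ) := by
  have hlt : ∀ ζ ∈ coordSlice (ellipsoid p) q 0, 0 < 1 - Complex.normSq ζ := fun ζ hζ => by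
    have := normSq_lt_one_of_mem_ellipsoid hζ
    simp only [Function.update_self] at this
    linarith
  refine (dz_dzbar_radial (isOpen_ellipsoid hp) (contDiffOn_ellipsoidPotential hp) (q := q) (i := 0)
    (F := fun s => -(1 / p + 2) * Real.log (1 - s) + Real.log (p + 1) - Real.log (p * Real.pi ^ 2))
    (F₁ := fun s => (1 / p + 2) / (1 - s)) (F₂ := fun s => (1 / p + 2) / (1 - s) ^ 2)
    ?_ ?_ ?_ hζ).1.trans ?_
  · intro ζ hζ
    rw [ellipsoidPotential, log_bergmanKernel_ellipsoid hp hζ rfl]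
    simp [hw]
  · intro ζ hζ
    have h := hlt ζ hζ
    have h1 : HasDerivAt (fun s : ℝ => 1 - s) (-1) (Complex.normSq ζ) := by
      simpa using (hasDerivAt_id (Complex.normSq ζ)).const_sub 1
    refine ((((h1.log h.ne').const_mul (-(1 / p + 2))).add_const _).sub_const _).congr_deriv ?_
    field_simp
  · intro ζ hζ
    have h := hlt ζ hζ
    have h1 : HasDerivAt (fun s : ℝ => 1 - s) (-1) (Complex.normSq ζ) := by
      simpa using (hasDerivAt_id (Complex.normSq ζ)).const_sub 1
    refine ((hasDerivAt_const _ (1 / p + 2)).div h1 h.ne').congr_deriv ?_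
    field_simp
    ring
  · have h := hlt ζ hζ
    congr 1
    field_simp
    ring

/-- The `k`-th derivative, divided by `(-1)^(k-1) (k-1)!`, of `log (p+1-(p-1)ut) - 3 log (1-ut)`. -/
noncomputable def sliceDeriv (p u : ℝ) (k : ℕ) (t : ℝ) : ℝ :=
  (-((p - 1) * u) / (p + 1 - (p - 1) * (u * t))) ^ k - 3 * (-u / (1 - u * t)) ^ k

/-- The logarithmic derivative `a / (b + a t)` of an affine function has derivative minus its
square. The family is therefore closed under differentiation, and all derivatives in `t` come from
one recursion. -/
lemma hasDerivAt_sliceDeriv {u t : ℝ} (k : ℕ) (h1 : p + 1 - (p - 1) * (u * t) ≠ 0)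
    (h2 : 1 - u * t ≠ 0) :
    HasDerivAt (sliceDeriv p u k) (-k * sliceDeriv p u (k + 1) t) t := by
  have e1 : HasDerivAt (fun t => p + 1 - (p - 1) * (u * t)) (-((p - 1) * u)) t := by
    simpa using (((hasDerivAt_id t).const_mul u).const_mul (p - 1)).const_sub (p + 1)
  have e2 : HasDerivAt (fun t => 1 - u * t) (-u) t := by
    simpa using ((hasDerivAt_id t).const_mul u).const_sub 1
  have e3 := ((hasDerivAt_const t (-((p - 1) * u))).div e1 h1).pow k
  have e4 := (((hasDerivAt_const t (-u)).div e2 h2).pow k).const_mul 3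
  refine (e3.sub e4).congr_deriv ?_
  rcases k with _ | k
  · simp
  · simp only [sliceDeriv, Nat.add_sub_cancel, Pi.div_apply, div_pow]
    field_simp
    ring

lemma slice_one_pos (hp : 0 < p) {ζ : ℂ} (hζ : ζ ∈ coordSlice (ellipsoid p) q 1) :
    0 < p + 1 - (p - 1) * ((1 - Complex.normSq (q 0)) ^ (-(1 / p)) * Complex.normSq ζ) ∧
      0 < 1 - (1 - Complex.normSq (q 0)) ^ (-(1 / p)) * Complex.normSq ζ := by
  have h1 := normSq_mul_rpow_lt_one hp hζ
  have h2 := normSq_lt_one_of_mem_ellipsoid hζ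
  simp only [Function.update_self, ne_eq, Fin.isValue, zero_ne_one, not_false_eq_true,
    Function.update_of_ne] at h1 h2
  have h3 : 0 ≤ (1 - Complex.normSq (q 0)) ^ (-(1 / p)) * Complex.normSq ζ :=
    mul_nonneg (Real.rpow_nonneg (by linarith) _) (Complex.normSq_nonneg _)
  exact ⟨affine_pos hp h3 h1, by linarith⟩

lemma potential_slice_one (hp : 0 < p) :
    (∀ ζ ∈ coordSlice (ellipsoid p) q 1, ellipsoidPotential p (Function.update q 1 ζ) =
      ((fun t => -(1 / p + 2) * Real.log (1 - Complex.normSq (q 0)) +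
        (Real.log (p + 1 - (p - 1) * ((1 - Complex.normSq (q 0)) ^ (-(1 / p)) * t)) -
          3 * Real.log (1 - (1 - Complex.normSq (q 0)) ^ (-(1 / p)) * t)) -
        Real.log (p * Real.pi ^ 2)) (Complex.normSq ζ) : ℝ)) ∧
    ∀ ζ ∈ coordSlice (ellipsoid p) q 1,
      HasDerivAt (fun t => -(1 / p + 2) * Real.log (1 - Complex.normSq (q 0)) +
        (Real.log (p + 1 - (p - 1) * ((1 - Complex.normSq (q 0)) ^ (-(1 / p)) * t)) -
          3 * Real.log (1 - (1 - Complex.normSq (q 0)) ^ (-(1 / p)) * t)) -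
        Real.log (p * Real.pi ^ 2))
      (sliceDeriv p ((1 - Complex.normSq (q 0)) ^ (-(1 / p))) 1 (Complex.normSq ζ))
      (Complex.normSq ζ) := by
  constructor
  · intro ζ hζ
    rw [ellipsoidPotential, log_bergmanKernel_ellipsoid hp hζ rfl]
    simp
  · intro ζ hζ
    obtain ⟨h1, h2⟩ := slice_one_pos hp hζ
    set u := (1 - Complex.normSq (q 0)) ^ (-(1 / p))
    set t := Complex.normSq ζ
    have e1 : HasDerivAt (fun t => p + 1 - (p - 1) * (u * t)) (-((p - 1) * u)) t := by
      simpa using (((hasDerivAt_id t).const_mul u).const_mul (p - 1)).const_sub (p + 1)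
    have e2 : HasDerivAt (fun t => 1 - u * t) (-u) t := by
      simpa using ((hasDerivAt_id t).const_mul u).const_sub 1
    refine ((((e1.log h1.ne').sub ((e2.log h2.ne').const_mul 3)).const_add _).sub_const
      _).congr_deriv ?_
    simp [sliceDeriv]

lemma hasDerivAt_sliceDeriv_of_mem (hp : 0 < p) (k : ℕ) {ζ : ℂ}
    (hζ : ζ ∈ coordSlice (ellipsoid p) q 1) :
    HasDerivAt (sliceDeriv p ((1 - Complex.normSq (q 0)) ^ (-(1 / p))) k)
      (-k * sliceDeriv p ((1 - Complex.normSq (q 0)) ^ (-(1 / p))) (k + 1) (Complex.normSq ζ))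
      (Complex.normSq ζ) :=
  hasDerivAt_sliceDeriv k (slice_one_pos hp hζ).1.ne' (slice_one_pos hp hζ).2.ne'

lemma dz_potential_one (hp : 0 < p) (hq : q ∈ ellipsoid p) (hw : q 1 = 0) :
    dz 1 (ellipsoidPotential p) q = 0 ∧ dzbar 1 (ellipsoidPotential p) q = 0 ∧
      dz 1 (dz 1 (ellipsoidPotential p)) q = 0 := by
  have hmem : (0 : ℂ) ∈ coordSlice (ellipsoid p) q 1 := by
    simpa [coordSlice, ← hw] using hq
  have hupd : Function.update q 1 0 = q := by rw [← hw, Function.update_eq_self]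
  obtain ⟨hF, hF₁⟩ := potential_slice_one (q := q) hp
  have h1 := dz_radial (isOpen_ellipsoid hp) (contDiffOn_ellipsoidPotential hp) hF hF₁ hmem
  have h2 := (dz_dzbar_radial (isOpen_ellipsoid hp) (contDiffOn_ellipsoidPotential hp) hF hF₁
    (F₂ := fun t => -(1 : ℕ) * sliceDeriv p ((1 - Complex.normSq (q 0)) ^ (-(1 / p))) 2 t)
    (fun ζ hζ => hasDerivAt_sliceDeriv_of_mem hp 1 hζ) hmem).2
  rw [hupd] at h1 h2
  exact ⟨h1.1.trans (by simp), h1.2.trans (by simp), h2.trans (by simp)⟩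

/-- The metric coefficient `g_{w w̄}` on a slice `z = const`. -/
lemma dz_dzbar_potential_one (hp : 0 < p) {ζ : ℂ} (hζ : ζ ∈ coordSlice (ellipsoid p) q 1) :
    dz 1 (dzbar 1 (ellipsoidPotential p)) (Function.update q 1 ζ) =
      ((fun t => sliceDeriv p ((1 - Complex.normSq (q 0)) ^ (-(1 / p))) 1 t -
        t * sliceDeriv p ((1 - Complex.normSq (q 0)) ^ (-(1 / p))) 2 t) (Complex.normSq ζ) : ℝ) := by
  obtain ⟨hF, hF₁⟩ := potential_slice_one (q := q) hp
  refine (dz_dzbar_radial (isOpen_ellipsoid hp) (contDiffOn_ellipsoidPotential hp) hF hF₁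
    (F₂ := fun t => -(1 : ℕ) * sliceDeriv p ((1 - Complex.normSq (q 0)) ^ (-(1 / p))) 2 t)
    (fun ζ hζ => hasDerivAt_sliceDeriv_of_mem hp 1 hζ) hζ).1.trans ?_
  congr 1
  push_cast
  ring

end AxisSlices

/-- A smooth function that vanishes on `w = 0` has vanishing `z`-derivatives there. -/
lemma dz_zero_eq_zero_of_vanishing (hp : 0 < p) {f : (Fin 2 → ℂ) → ℂ}
    (hf : ContDiffOn ℝ ∞ f (ellipsoid p)) (h0 : ∀ q ∈ ellipsoid p, q 1 = 0 → f q = 0)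
    {q : Fin 2 → ℂ} (hq : q ∈ ellipsoid p) (hw : q 1 = 0) : dz 0 f q = 0 ∧ dzbar 0 f q = 0 := by
  have h := dz_slice_eq_zero (isOpen_ellipsoid hp) hf (q := q) (i := 0) (ζ := q 0)
    (fun ζ hζ => h0 _ hζ (by simpa using hw)) (by simpa [coordSlice] using hq)
  simpa using h

/-! ### Vanishing of the off-diagonal terms on the axis. -/

section MixedTerms

variable {q : Fin 2 → ℂ}

lemma metric_zero_one (hp : 0 < p) (hq : q ∈ ellipsoid p) (hw : q 1 = 0) :
    dz 0 (dzbar 1 (ellipsoidPotential p)) q = 0 :=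
  (dz_zero_eq_zero_of_vanishing hp
    ((contDiffOn_ellipsoidPotential hp).dzbar (isOpen_ellipsoid hp) 1)
    (fun _ h h' => (dz_potential_one hp h h').2.1) hq hw).1

lemma dz_metric_zero_one (hp : 0 < p) (hq : q ∈ ellipsoid p) (hw : q 1 = 0) :
    dz 0 (dz 0 (dzbar 1 (ellipsoidPotential p))) q = 0 :=
  (dz_zero_eq_zero_of_vanishing hp
    (((contDiffOn_ellipsoidPotential hp).dzbar (isOpen_ellipsoid hp) 1).dz (isOpen_ellipsoid hp) 0)
    (fun _ h h' => metric_zero_one hp h h') hq hw).1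

/-- Here the outer derivative is transversal to the axis. Commuting the two makes it tangential, and
`∂_w log K` vanishes along the axis. -/
lemma metric_one_zero (hp : 0 < p) (hq : q ∈ ellipsoid p) (hw : q 1 = 0) :
    dz 1 (dzbar 0 (ellipsoidPotential p)) q = 0 := by
  rw [dz_dzbar_comm (isOpen_ellipsoid hp) (contDiffOn_ellipsoidPotential hp) 1 0 hq]
  exact (dz_zero_eq_zero_of_vanishing hp
    ((contDiffOn_ellipsoidPotential hp).dz (isOpen_ellipsoid hp) 1)
    (fun _ h h' => (dz_potential_one hp h h').1) hq hw).2

/-- `∂_z̄` is moved outside past both `w`-derivatives, so that it acts on `∂_w² log K`, which is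
zero on the axis. -/
lemma dz_metric_one_zero (hp : 0 < p) (hq : q ∈ ellipsoid p) (hw : q 1 = 0) :
    dz 1 (dz 1 (dzbar 0 (ellipsoidPotential p))) q = 0 := by
  have hU := isOpen_ellipsoid hp
  have hf := contDiffOn_ellipsoidPotential hp
  have h1 : dz 1 (dzbar 0 (ellipsoidPotential p)) =ᶠ[nhds q]
      dzbar 0 (dz 1 (ellipsoidPotential p)) := by
    filter_upwards [hU.mem_nhds hq] with x hx using dz_dzbar_comm hU hf 1 0 hx
  rw [h1.dz_eq, dz_dzbar_comm hU (hf.dz hU 1) 1 0 hq]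
  exact (dz_zero_eq_zero_of_vanishing hp ((hf.dz hU 1).dz hU 1)
    (fun _ h h' => (dz_potential_one hp h h').2.2) hq hw).2

end MixedTerms

/-! ### Values of the metric and of its derivatives on the axis. -/

section Values

variable {q : Fin 2 → ℂ}

lemma metric_zero_zero (hp : 0 < p) (hq : q ∈ ellipsoid p) (hw : q 1 = 0) :
    bergmanMetric (ellipsoid p) q 0 0 =
      (((1 / p + 2) / (1 - Complex.normSq (q 0)) ^ 2 : ℝ) : ℂ) := by
  have := dz_dzbar_potential_zero hp hw (ζ := q 0) (by simpa [coordSlice] using hq)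
  rw [Function.update_eq_self] at this
  exact this

lemma metric_one_one (hp : 0 < p) (hq : q ∈ ellipsoid p) (hw : q 1 = 0) :
    bergmanMetric (ellipsoid p) q 1 1 =
      (((1 - Complex.normSq (q 0)) ^ (-(1 / p)) * (2 * (p + 2) / (p + 1)) : ℝ) : ℂ) := by
  have := dz_dzbar_potential_one (q := q) hp (ζ := q 1) (by simpa [coordSlice] using hq)
  rw [Function.update_eq_self] at this
  refine this.trans ?_
  rw [hw]
  have h1 : p + 1 ≠ 0 := by positivity
  congr 1
  simp [sliceDeriv]
  field_simp
  ring

lemma dz_dzbar_metric_zero_zero (hp : 0 < p) (hq : q ∈ ellipsoid p) (hw : q 1 = 0) :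
    dz 0 (dzbar 0 fun x => bergmanMetric (ellipsoid p) x 0 0) q =
        (((1 / p + 2) * (2 + 4 * Complex.normSq (q 0)) /
          (1 - Complex.normSq (q 0)) ^ 4 : ℝ) : ℂ) ∧
      dz 0 (fun x => bergmanMetric (ellipsoid p) x 0 0) q =
        (((1 / p + 2) * 2 / (1 - Complex.normSq (q 0)) ^ 3 : ℝ) : ℂ) * starRingEnd ℂ (q 0) ∧
      dzbar 0 (fun x => bergmanMetric (ellipsoid p) x 0 0) q =
        (((1 / p + 2) * 2 / (1 - Complex.normSq (q 0)) ^ 3 : ℝ) : ℂ) * q 0 := by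
  have hU := isOpen_ellipsoid hp
  have hg := ((contDiffOn_ellipsoidPotential hp).dzbar hU 0).dz hU 0
  have hmem : q 0 ∈ coordSlice (ellipsoid p) q 0 := by simpa [coordSlice] using hq
  have hlt : ∀ ζ ∈ coordSlice (ellipsoid p) q 0, 0 < 1 - Complex.normSq ζ := fun ζ hζ => by
    have := normSq_lt_one_of_mem_ellipsoid hζ
    simp only [Function.update_self] at this
    linarith
  have hderiv : ∀ c : ℝ, ∀ n : ℕ, ∀ ζ ∈ coordSlice (ellipsoid p) q 0,
      HasDerivAt (fun s : ℝ => c / (1 - s) ^ n) (c * n / (1 - Complex.normSq ζ) ^ (n + 1))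
        (Complex.normSq ζ) := by
    intro c n ζ hζ
    have h := hlt ζ hζ
    have h1 : HasDerivAt (fun s : ℝ => 1 - s) (-1) (Complex.normSq ζ) := by
      simpa using (hasDerivAt_id (Complex.normSq ζ)).const_sub 1
    refine ((hasDerivAt_const _ c).div (h1.pow n) (pow_pos h n).ne').congr_deriv ?_
    rcases n with _ | n
    · simp
    · simp only [Nat.add_sub_cancel, Pi.pow_apply]
      field_simp
      ring
  have hF : ∀ ζ ∈ coordSlice (ellipsoid p) q 0,
      dz 0 (dzbar 0 (ellipsoidPotential p)) (Function.update q 0 ζ) =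
        ((fun s : ℝ => (1 / p + 2) / (1 - s) ^ 2) (Complex.normSq ζ) : ℝ) :=
    fun ζ hζ => dz_dzbar_potential_zero hp hw hζ
  have h1 := dz_radial hU hg hF
    (F₁ := fun s => (1 / p + 2) * (2 : ℕ) / (1 - s) ^ (2 + 1)) (hderiv _ 2) hmem
  have h2 := (dz_dzbar_radial hU hg hF
    (F₁ := fun s => (1 / p + 2) * (2 : ℕ) / (1 - s) ^ (2 + 1)) (hderiv _ 2)
    (F₂ := fun s => (1 / p + 2) * (2 : ℕ) * (3 : ℕ) / (1 - s) ^ (3 + 1)) (hderiv _ 3) hmem).1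
  rw [Function.update_eq_self] at h1 h2
  refine ⟨h2.trans ?_, h1.1, h1.2⟩
  have h := hlt _ hmem
  congr 1
  push_cast
  field_simp
  ring

lemma dz_dzbar_metric_one_one (hp : 0 < p) (hq : q ∈ ellipsoid p) (hw : q 1 = 0) :
    dz 1 (dzbar 1 fun x => bergmanMetric (ellipsoid p) x 1 1) q =
        ((((1 - Complex.normSq (q 0)) ^ (-(1 / p))) ^ 2 *
          (4 * (1 + 4 * p + p ^ 2) / (p + 1) ^ 2) : ℝ) : ℂ) ∧
      dz 1 (fun x => bergmanMetric (ellipsoid p) x 1 1) q = 0 := by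
  have hU := isOpen_ellipsoid hp
  have hg := ((contDiffOn_ellipsoidPotential hp).dzbar hU 1).dz hU 1
  have hmem : q 1 ∈ coordSlice (ellipsoid p) q 1 := by simpa [coordSlice] using hq
  have hF := fun ζ hζ => dz_dzbar_potential_one (q := q) hp (ζ := ζ) hζ
  have hd := fun (k : ℕ) (ζ : ℂ) hζ => hasDerivAt_sliceDeriv_of_mem (q := q) hp k (ζ := ζ) hζ
  set S := sliceDeriv p ((1 - Complex.normSq (q 0)) ^ (-(1 / p))) with hS
  -- From `S k' = -k S (k+1)`, two differentiations of `S 1 - t S 2` give the functions below. At `t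
  -- = 0` only `-2 S 2` contributes to `∂_w ∂_w̄ g_{w w̄}`.
  have hF₁ : ∀ ζ ∈ coordSlice (ellipsoid p) q 1, HasDerivAt (fun t => S 1 t - t * S 2 t)
      ((fun t => -2 * S 2 t + 2 * (t * S 3 t)) (Complex.normSq ζ)) (Complex.normSq ζ) :=
    fun ζ hζ => ((hd 1 ζ hζ).sub ((hasDerivAt_id _).mul (hd 2 ζ hζ))).congr_deriv (by
      simp
      ring)
  have hF₂ : ∀ ζ ∈ coordSlice (ellipsoid p) q 1,
      HasDerivAt (fun t => -2 * S 2 t + 2 * (t * S 3 t))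
      ((fun t => 6 * S 3 t - 6 * (t * S 4 t)) (Complex.normSq ζ)) (Complex.normSq ζ) :=
    fun ζ hζ => (((hd 2 ζ hζ).const_mul (-2)).add
      (((hasDerivAt_id _).mul (hd 3 ζ hζ)).const_mul 2)).congr_deriv (by
      simp
      ring)
  have h1 := (dz_radial hU hg (F := fun t => S 1 t - t * S 2 t)
    (F₁ := fun t => -2 * S 2 t + 2 * (t * S 3 t)) hF hF₁ hmem).1
  have h2 := (dz_dzbar_radial hU hg (F := fun t => S 1 t - t * S 2 t)
    (F₁ := fun t => -2 * S 2 t + 2 * (t * S 3 t))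
    (F₂ := fun t => 6 * S 3 t - 6 * (t * S 4 t)) hF hF₁ hF₂ hmem).1
  rw [Function.update_eq_self] at h1 h2
  refine ⟨h2.trans ?_, h1.trans (by simp [hw])⟩
  have h3 : p + 1 ≠ 0 := by positivity
  rw [hw, hS]
  congr 1
  simp [sliceDeriv]
  field_simp
  ring

lemma metric_zero_zero_ne_zero (hp : 0 < p) (hq : q ∈ ellipsoid p) (hw : q 1 = 0) :
    bergmanMetric (ellipsoid p) q 0 0 ≠ 0 := by
  have hs := normSq_lt_one_of_mem_ellipsoid hq
  have hs1 : 0 < 1 - Complex.normSq (q 0) := by linarith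
  rw [metric_zero_zero hp hq hw, Complex.ofReal_ne_zero]
  positivity

lemma metric_one_one_ne_zero (hp : 0 < p) (hq : q ∈ ellipsoid p) (hw : q 1 = 0) :
    bergmanMetric (ellipsoid p) q 1 1 ≠ 0 := by
  have hs := normSq_lt_one_of_mem_ellipsoid hq
  have hs1 : 0 < 1 - Complex.normSq (q 0) := by linarith
  rw [metric_one_one hp hq hw, Complex.ofReal_ne_zero]
  positivity

theorem holSecCurvature_ellipsoid_zero (hp : 0 < p) (hq : q ∈ ellipsoid p) (hw : q 1 = 0) :
    holSecCurvature (bergmanMetric (ellipsoid p)) q (Pi.single 0 1) =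
      ((-(2 * p / (1 + 2 * p)) : ℝ) : ℂ) := by
  have hs1 : 0 < 1 - Complex.normSq (q 0) := by linarith [normSq_lt_one_of_mem_ellipsoid hq]
  obtain ⟨h1, h2, h3⟩ := dz_dzbar_metric_zero_zero hp hq hw
  rw [holSecCurvature_single, curvatureComponent_diag_of_fin_two _ q (metric_zero_one hp hq hw)
    (metric_one_zero hp hq hw) (metric_zero_zero_ne_zero hp hq hw)
    (metric_one_one_ne_zero hp hq hw) 0 ?_, h1, h2, h3, metric_zero_zero hp hq hw]
  · have hn : starRingEnd ℂ (q 0) * q 0 = (Complex.normSq (q 0) : ℂ) :=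
      (Complex.normSq_eq_conj_mul_self).symm
    set s := Complex.normSq (q 0)
    have hR : -(((1 / p + 2) * (2 + 4 * s) / (1 - s) ^ 4 : ℝ) : ℂ) +
        (((1 / p + 2) / (1 - s) ^ 2 : ℝ) : ℂ)⁻¹ *
          ((((1 / p + 2) * 2 / (1 - s) ^ 3 : ℝ) : ℂ) * starRingEnd ℂ (q 0)) *
          ((((1 / p + 2) * 2 / (1 - s) ^ 3 : ℝ) : ℂ) * q 0) =
        ((-((1 / p + 2) * (2 + 4 * s) / (1 - s) ^ 4) + ((1 / p + 2) / (1 - s) ^ 2)⁻¹ *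
          ((1 / p + 2) * 2 / (1 - s) ^ 3) ^ 2 * s : ℝ) : ℂ) := by
      push_cast
      rw [← hn]
      ring
    rw [hR, ← Complex.ofReal_pow, ← Complex.ofReal_div]
    congr 1
    have hp2 : 0 < 1 + 2 * p := by positivity
    have hp3 : 0 < 1 / p + 2 := by positivity
    have hk : 1 / p + 2 = (1 + 2 * p) / p := by field_simp
    rw [hk]
    field_simp
    ring
  · intro j hj
    fin_cases j
    · exact absurd rfl hj
    · exact dz_metric_zero_one hp hq hw

theorem holSecCurvature_ellipsoid_one (hp : 0 < p) (hq : q ∈ ellipsoid p) (hw : q 1 = 0) :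
    holSecCurvature (bergmanMetric (ellipsoid p)) q (Pi.single 1 1) =
      ((-((1 + 4 * p + p ^ 2) / (2 + p) ^ 2) : ℝ) : ℂ) := by
  have hs1 : 0 < 1 - Complex.normSq (q 0) := by linarith [normSq_lt_one_of_mem_ellipsoid hq]
  obtain ⟨h1, h2⟩ := dz_dzbar_metric_one_one hp hq hw
  rw [holSecCurvature_single, curvatureComponent_diag_of_fin_two _ q (metric_zero_one hp hq hw)
    (metric_one_zero hp hq hw) (metric_zero_zero_ne_zero hp hq hw)
    (metric_one_one_ne_zero hp hq hw) 1 ?_, h1, h2, metric_one_one hp hq hw]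
  · have hu := Real.rpow_pos_of_pos hs1 (-(1 / p))
    set u := (1 - Complex.normSq (q 0)) ^ (-(1 / p))
    rw [mul_zero, zero_mul, add_zero, ← Complex.ofReal_neg, ← Complex.ofReal_pow,
      ← Complex.ofReal_div]
    congr 1
    field_simp
    ring
  · intro j hj
    fin_cases j
    · exact dz_metric_one_zero hp hq hw
    · exact absurd rfl hj

end Values

end Curvature

theorem mainTheorem8 (p : ℝ) (hp : 0 < p) (q : Fin 2 → ℂ) (hq : q ∈ ellipsoid p)
    (hz : q 0 = starRingEnd ℂ (q 0)) (hw : q 1 = 0) :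
    holSecCurvature (bergmanMetric (ellipsoid p)) q (Pi.single 0 1) =
        ((-(2 * p / (1 + 2 * p)) : ℝ) : ℂ) ∧
      holSecCurvature (bergmanMetric (ellipsoid p)) q (Pi.single 1 1) =
        ((-((1 + 4 * p + p ^ 2) / (2 + p) ^ 2) : ℝ) : ℂ) ∧
      (holSecCurvature (bergmanMetric (ellipsoid p)) q (Pi.single 0 1) =
          holSecCurvature (bergmanMetric (ellipsoid p)) q (Pi.single 1 1) ↔ p = 1) := by
  have h0 := holSecCurvature_ellipsoid_zero hp hq hw
  have h1 := holSecCurvature_ellipsoid_one hp hq hw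
  refine ⟨h0, h1, ?_⟩
  rw [h0, h1, Complex.ofReal_inj, neg_inj, div_eq_div_iff (by positivity) (by positivity)]
  constructor
  · intro h
    -- The cross-multiplied sides differ by exactly `(p - 1)²`; the cubic terms cancel.
    have h2 : (p - 1) ^ 2 = 0 := by linarith
    linarith [pow_eq_zero_iff (two_ne_zero) |>.1 h2]
  · rintro rfl
    norm_num
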